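/- Let $r \ge 2$ be a fixed integer. For integers $q \ge 1$, $\lambda$ and $V \ge 1$ let $K_{r,q}(\lambda,V)$ denote the number of integer vectors $(v_1,\dots,v_{2r})$ with $|v_1|,\dots,|v_{2r}| \le V$ such that every $\lambda+v_i$ is invertible modulo $q$ and $$\frac{1}{\lambda+v_1}+\dots+\frac{1}{\lambda+v_r}\equiv\frac{1}{\lambda+v_{r+1}}+\dots+\frac{1}{\lambda+v_{2r}} \pmod q,$$ where $1/(\lambda+v_i)$ denotes the multiplicative inverse modulo $q$. If $V \ll q^{1/(4r(r-1))}$, then $$K_{r,q}(\lambda,V)\ll V^{r}q^{o(1)}$$ uniformly in $\lambda$ and $V$. That is, for every $C>0$ and every $\varepsilon>0$ there is a constant $A=A(r,C,\varepsilon)>0$ such that for all integers $q\ge 1$, all integers $\lambda$ and all integers $V$ with $1\le V\le C q^{1/(4r(r-1))}$ one has $$K_{r,q}(\lambda,V)\le A\,V^{r}q^{\varepsilon}.$$ -/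

import Mathlib

/-- The vector `v = (v₁, …, v_{2r})`, with its first `r` entries `v.1` and its last `r` entries
`v.2`, solves
`1/(lam+v₁) + ⋯ + 1/(lam+v_r) ≡ 1/(lam+v_{r+1}) + ⋯ + 1/(lam+v_{2r})  (mod q)`.
As usual a solution has every `lam + v_i` invertible modulo `q`, and `1/(lam+v_i)` is the
multiplicative inverse modulo `q`. -/
def IsKloostermanSolution (r q : ℕ) (lam : ℤ) (v : (Fin r → ℤ) × (Fin r → ℤ)) : Prop :=
  (∀ i, IsUnit ((lam + v.1 i : ℤ) : ZMod q)) ∧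
  (∀ i, IsUnit ((lam + v.2 i : ℤ) : ZMod q)) ∧
  ∑ i, ((lam + v.1 i : ℤ) : ZMod q)⁻¹ = ∑ i, ((lam + v.2 i : ℤ) : ZMod q)⁻¹

open Classical in
/-- `K_{r,q}(lam, V)`: the number of integer solutions `v` of the congruence with
`|v_i| ≤ V` for all `1 ≤ i ≤ 2r`. -/
noncomputable def kloostermanCount (r q : ℕ) (lam : ℤ) (V : ℕ) : ℕ :=
  (((Fintype.piFinset fun _ : Fin r => Finset.Icc (-(V : ℤ)) (V : ℤ)) ×ˢ
    (Fintype.piFinset fun _ : Fin r => Finset.Icc (-(V : ℤ)) (V : ℤ))).filter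
      (IsKloostermanSolution r q lam)).card

/-!
# Congruences with sums of reciprocals over short intervals

Let `K` be the number of solutions of `∑ 1/(lam + vᵢ) ≡ ∑ 1/(lam + v_{r+j}) (mod q)` with
`|vᵢ| ≤ V`. Orthogonality of the additive characters modulo `q` writes `q * K` as a `2r`-th moment
of character sums (`sum_norm_reciprocalCharSum_pow`), so Hölder's inequality allows an interval to
be cut into boundedly many pieces (`kloostermanCount_le_sum`). It is therefore enough to treat
`V ≤ c q ^ (1 / (4r(r-1)))` with a small constant `c`.

For a tuple `w` of `2r` integers with signs `s`, let `R_w` be the numerator of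
`∑ sᵢ / (X + wᵢ)`, equal denominators being collected first (`signedCount`, `reciprocalNum`). If `w`
is a solution, then `q` divides `R_w(lam)`. Hence `q` divides the resultant of any two such
numerators. These have degree at most `2r - 2`, and the coefficient of `X ^ k` is
`O(V ^ (2r - 1 - k))`, so the resultant is `O(V ^ (4r(r-1)))` (`abs_resultant_le`), which is less
than `q`. So all resultants vanish: each solution with `R_w ≠ 0` shares an irreducible factor
`f ∈ ℤ[X]` with one fixed such solution. There are boundedly many `f`, and by Mahler measure their
coefficients are bounded by a power of `V`. The congruence has become an identity: `f ∣ R_w`.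

It remains to count, for one `f`, the tuples in the box with `f ∣ R_w`
(`exists_card_le_of_common_factor`). Put `F x = f (-x)` and let `E` be the resultant of `f` and
`f'`. If a prime power `p ^ e` divides `F(wᵢ)` and `e` is large compared with the power of `p` in
`E`, Hensel's lemma gives a root `z ∈ ℤ_p` of `f` close to `-wᵢ`. As `∑ sⱼ / (z + wⱼ) = 0`, some
other `z + wⱼ` is at least as small `p`-adically as `z + wᵢ`, so `wᵢ ≡ wⱼ` modulo nearly `p ^ e`. So,
up to a divisor of `E ^ 2`, the number `F(wᵢ)` divides the least common multiple of its common
divisors with the differences `wᵢ - wⱼ` (`strippedValue_dvd_sharedPart`).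

Now reveal the coordinates one by one. A common divisor of `F(wᵢ)` and `wᵢ - wⱼ` divides `F(wⱼ)`,
so once `wⱼ` is known there are `V ^ o(1)` possibilities for it, and each confines `wᵢ` to a residue
class. If `h⁻` and `h⁺` are the parts of `F(wᵢ)` shared with earlier and with later coordinates, then
`h⁻ h⁺ ≥ |F(wᵢ)|` up to `E ^ 2`. The numbers of candidates for `wᵢ` when revealing forwards and when
revealing backwards then have product at most about `V`, and so in one of the two orders the total
number of candidates is at most `V ^ (r + o(1))` (`card_mutually_dividing_le`).
-/

open Polynomial Finset

/-! ### Revealing the coordinates of a tuple one by one -/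

/-- The number `|F x|`, with its common divisor with `E` removed. -/
def strippedValue (F : ℤ → ℤ) (E : ℕ) (x : ℤ) : ℕ :=
  (F x).natAbs / Nat.gcd (F x).natAbs E

/-- The part of `strippedValue F E x` that is accounted for by congruences between `x` and the
elements `y` of `B` with `F y ≠ 0`. -/
def sharedPart (F : ℤ → ℤ) (E : ℕ) (B : Finset ℤ) (x : ℤ) : ℕ :=
  (B.filter (F · ≠ 0)).lcm fun y => Nat.gcd (strippedValue F E x) (x - y).natAbs

/-- The weight of `x` given `B`: roughly the reciprocal of the number of candidates `x` that remain
once the elements of `B` and the part of `F x` that they share with `x` are known. -/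
noncomputable def revealWeight (F : ℤ → ℤ) (E V : ℕ) (B : Finset ℤ) (x : ℤ) : ℝ :=
  if F x = 0 then 1 else min 1 ((sharedPart F E B x : ℝ) / min (V : ℝ) (strippedValue F E x))

lemma strippedValue_mul_gcd (F : ℤ → ℤ) (E : ℕ) (x : ℤ) :
    strippedValue F E x * Nat.gcd (F x).natAbs E = (F x).natAbs :=
  Nat.div_mul_cancel (Nat.gcd_dvd_left _ _)

lemma strippedValue_pos {F : ℤ → ℤ} {E : ℕ} {x : ℤ} (hx : F x ≠ 0) : 0 < strippedValue F E x := by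
  have h := strippedValue_mul_gcd F E x
  rcases Nat.eq_zero_or_pos (strippedValue F E x) with h0 | h0
  · rw [h0, zero_mul] at h
    exact absurd (Int.natAbs_eq_zero.mp h.symm) hx
  · exact h0

lemma strippedValue_dvd (F : ℤ → ℤ) (E : ℕ) (x : ℤ) : strippedValue F E x ∣ (F x).natAbs :=
  ⟨_, (strippedValue_mul_gcd F E x).symm⟩

lemma sharedPart_dvd (F : ℤ → ℤ) (E : ℕ) (B : Finset ℤ) (x : ℤ) :
    sharedPart F E B x ∣ strippedValue F E x :=
  Finset.lcm_dvd fun _ _ => Nat.gcd_dvd_left _ _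

lemma sharedPart_pos {F : ℤ → ℤ} {E : ℕ} {B : Finset ℤ} {x : ℤ} (hx : F x ≠ 0) :
    0 < sharedPart F E B x :=
  Nat.pos_of_dvd_of_pos (sharedPart_dvd F E B x) (strippedValue_pos hx)

lemma revealWeight_nonneg (F : ℤ → ℤ) (E V : ℕ) (B : Finset ℤ) (x : ℤ) :
    0 ≤ revealWeight F E V B x := by
  unfold revealWeight
  split_ifs
  · exact zero_le_one
  · positivity

/-- Elements of `[-V, V]` that are pairwise congruent modulo `h` number at most `2V/h + 1`. -/
lemma card_le_of_pairwise_dvd_sub {V h : ℕ} (hh : 0 < h) {S : Finset ℤ}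
    (hS : S ⊆ Icc (-(V : ℤ)) V) (hdvd : ∀ x ∈ S, ∀ y ∈ S, (h : ℤ) ∣ x - y) :
    (S.card : ℝ) ≤ 2 * V / h + 1 := by
  have hinj : Set.InjOn (fun x : ℤ => ((x + V) / h).toNat) (S : Set ℤ) := by
    intro x hx y hy hxy
    have hx' := Finset.mem_Icc.mp (hS hx)
    have hy' := Finset.mem_Icc.mp (hS hy)
    have hhz : (0 : ℤ) < h := by exact_mod_cast hh
    have h1 : 0 ≤ (x + V) / h := Int.ediv_nonneg (by omega) hhz.le
    have h2 : 0 ≤ (y + V) / h := Int.ediv_nonneg (by omega) hhz.le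
    have hq : (x + V) / h = (y + V) / h := by
      simp only at hxy
      omega
    obtain ⟨k, hk⟩ := hdvd x hx y hy
    have hm : (x + V) % h = (y + V) % h := by
      apply Int.ModEq.symm
      exact (Int.modEq_iff_dvd).mpr ⟨k, by linarith⟩
    have e1 := Int.mul_ediv_add_emod (x + V) h
    have e2 := Int.mul_ediv_add_emod (y + V) h
    rw [hq, hm] at e1
    omega
  have hmaps : Set.MapsTo (fun x : ℤ => ((x + V) / h).toNat) (S : Set ℤ)
      (Finset.range (2 * V / h + 1) : Finset ℕ) := by
    intro x hx
    have hx' := Finset.mem_Icc.mp (hS hx)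
    have hhz : (0 : ℤ) < h := by exact_mod_cast hh
    simp only [Finset.coe_range, Set.mem_Iio]
    have : (x + V) / h ≤ ((2 * V / h : ℕ) : ℤ) := by
      push_cast
      exact Int.ediv_le_ediv hhz (by omega)
    exact Nat.lt_succ_of_le (Int.toNat_le.mpr this)
  have hcard := Finset.card_le_card_of_injOn _ hmaps hinj
  rw [Finset.card_range] at hcard
  calc (S.card : ℝ) ≤ ((2 * V / h + 1 : ℕ) : ℝ) := by exact_mod_cast hcard
    _ ≤ 2 * V / h + 1 := by
      push_cast
      have := @Nat.cast_div_le ℝ _ _ _ (2 * V) h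
      push_cast at this
      linarith

/-- In a class where the shared part divides the stripped values, summing `h / strippedValue` costs
only a divisor bound, a bound for the fibres of `F` and a logarithm. -/
lemma sum_div_strippedValue_le {F : ℤ → ℤ} {E V D T X h : ℕ} (hE : E ≠ 0) (hh : 0 < h)
    {S : Finset ℤ} (hS : S ⊆ Icc (-(V : ℤ)) V)
    (hX : ∀ x ∈ Icc (-(V : ℤ)) V, (F x).natAbs ≤ X)
    (hD : ∀ k : ℕ, #{x ∈ Icc (-(V : ℤ)) V | (F x).natAbs = k} ≤ D)
    (hT : #E.divisors ≤ T)
    (hne : ∀ x ∈ S, F x ≠ 0) (hdvd : ∀ x ∈ S, h ∣ strippedValue F E x) :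
    ∑ x ∈ S, (h : ℝ) / strippedValue F E x ≤ T * (D * (1 + Real.log X)) := by
  classical
  have hmaps : ∀ x ∈ S, (Nat.gcd (F x).natAbs E, strippedValue F E x / h) ∈
      E.divisors ×ˢ Icc 1 X := by
    intro x hx
    have hpos := strippedValue_pos (E := E) (hne x hx)
    refine Finset.mem_product.mpr ⟨Nat.mem_divisors.mpr ⟨Nat.gcd_dvd_right _ _, hE⟩,
      Finset.mem_Icc.mpr ⟨Nat.div_pos (Nat.le_of_dvd hpos (hdvd x hx)) hh, ?_⟩⟩
    calc strippedValue F E x / h ≤ strippedValue F E x := Nat.div_le_self _ _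
      _ ≤ (F x).natAbs := Nat.le_of_dvd (Int.natAbs_pos.mpr (hne x hx)) (strippedValue_dvd F E x)
      _ ≤ X := hX x (hS hx)
  rw [← Finset.sum_fiberwise_of_maps_to hmaps]
  have hfib : ∀ p ∈ E.divisors ×ˢ Icc 1 X,
      ∑ x ∈ S with (Nat.gcd (F x).natAbs E, strippedValue F E x / h) = p,
        (h : ℝ) / strippedValue F E x ≤ D * ((p.2 : ℝ))⁻¹ := by
    rintro ⟨b, k⟩ -
    have hval : ∀ x ∈ S.filter (fun x => (Nat.gcd (F x).natAbs E, strippedValue F E x / h) = (b, k)),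
        (h : ℝ) / strippedValue F E x = (k : ℝ)⁻¹ ∧ (F x).natAbs = h * k * b := by
      intro x hx
      obtain ⟨hxS, hxp⟩ := Finset.mem_filter.mp hx
      obtain ⟨hb, hk⟩ := Prod.mk.inj hxp
      have hs : strippedValue F E x = h * k := by
        rw [← hk, Nat.mul_div_cancel' (hdvd x hxS)]
      constructor
      · rw [hs]
        push_cast
        have : (h : ℝ) ≠ 0 := by positivity
        field_simp
      · rw [← strippedValue_mul_gcd F E x, hs, hb]
    rw [Finset.sum_congr rfl fun x hx => (hval x hx).1, Finset.sum_const, nsmul_eq_mul]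
    have hc : #{x ∈ S | (Nat.gcd (F x).natAbs E, strippedValue F E x / h) = (b, k)} ≤ D := by
      refine le_trans (Finset.card_le_card ?_) (hD (h * k * b))
      intro x hx
      exact Finset.mem_filter.mpr ⟨hS (Finset.mem_filter.mp hx).1, (hval x hx).2⟩
    gcongr
  refine (Finset.sum_le_sum hfib).trans ?_
  rw [Finset.sum_product]
  simp only [Finset.sum_const, nsmul_eq_mul, ← Finset.mul_sum]
  have hharm : ∑ k ∈ Icc 1 X, ((k : ℝ))⁻¹ ≤ 1 + Real.log X := by
    have := harmonic_le_one_add_log X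
    rw [harmonic_eq_sum_Icc] at this
    push_cast at this
    exact this
  have h0 : 0 ≤ ∑ k ∈ Icc 1 X, ((k : ℝ))⁻¹ := Finset.sum_nonneg fun _ _ => by positivity
  gcongr

/-- Given `B`, the weights of all candidates sum to a quantity that is small compared with the
number of candidates. -/
lemma sum_revealWeight_le {F : ℤ → ℤ} (hF : ∀ x y, x - y ∣ F x - F y) {E V D T X n : ℕ}
    (hE : E ≠ 0) (hV : 1 ≤ V)
    (hX : ∀ x ∈ Icc (-(V : ℤ)) V, (F x).natAbs ≤ X) (hX1 : 1 ≤ X)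
    (hD : ∀ k : ℕ, #{x ∈ Icc (-(V : ℤ)) V | (F x).natAbs = k} ≤ D)
    (hTE : #E.divisors ≤ T)
    (hTF : ∀ x ∈ Icc (-(V : ℤ)) V, F x ≠ 0 → #(F x).natAbs.divisors ≤ T)
    {B : Finset ℤ} (hB : B ⊆ Icc (-(V : ℤ)) V) (hBn : #B ≤ n) :
    ∑ x ∈ Icc (-(V : ℤ)) V, revealWeight F E V B x ≤
      D + (T : ℝ) ^ n * (3 + T * (D * (1 + Real.log X))) := by
  classical
  have hT1 : 1 ≤ T := le_trans (Finset.card_pos.mpr ⟨1, Nat.one_mem_divisors.mpr hE⟩) hTE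
  have hV0 : (0 : ℝ) < V := by exact_mod_cast hV
  have hlog : 0 ≤ Real.log X := Real.log_nonneg (by exact_mod_cast hX1)
  set S := Icc (-(V : ℤ)) V with hSdef
  rw [← Finset.sum_filter_add_sum_filter_not S (fun x => F x = 0)]
  apply add_le_add
  · rw [Finset.sum_congr rfl (g := fun _ => (1 : ℝ))]
    · simp only [Finset.sum_const, nsmul_eq_mul, mul_one]
      have := hD 0
      simp only [Int.natAbs_eq_zero] at this
      exact_mod_cast this
    · intro x hx
      simp [revealWeight, (Finset.mem_filter.mp hx).2]
  -- The remaining `x` are classified by the tuple of their common divisors with the `x - y`.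
  set B' := B.filter (F · ≠ 0) with hB'
  let G : ℤ → (∀ y ∈ B', ℕ) := fun x y _ => Nat.gcd (strippedValue F E x) (x - y).natAbs
  have hmaps : ∀ x ∈ S.filter (fun x => ¬ F x = 0), G x ∈ B'.pi fun y => (F y).natAbs.divisors := by
    intro x hx
    refine Finset.mem_pi.mpr fun y hy => ?_
    have hy0 := (Finset.mem_filter.mp hy).2
    refine Nat.mem_divisors.mpr ⟨?_, Int.natAbs_ne_zero.mpr hy0⟩
    have h1 : ((G x y hy : ℕ) : ℤ) ∣ F x :=
      Int.natCast_dvd.mpr ((Nat.gcd_dvd_left _ _).trans (strippedValue_dvd F E x))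
    have h2 : ((G x y hy : ℕ) : ℤ) ∣ F x - F y :=
      (Int.natCast_dvd.mpr (Nat.gcd_dvd_right _ _)).trans (hF x y)
    exact Int.natCast_dvd.mp ((dvd_sub_right h1).mp h2)
  rw [← Finset.sum_fiberwise_of_maps_to hmaps]
  have hfib : ∀ g ∈ B'.pi fun y => (F y).natAbs.divisors,
      ∑ x ∈ S.filter (fun x => ¬ F x = 0) with G x = g, revealWeight F E V B x ≤
        3 + T * (D * (1 + Real.log X)) := by
    intro g hg
    set R := (S.filter (fun x => ¬ F x = 0)).filter (fun x => G x = g) with hR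
    rcases R.eq_empty_or_nonempty with h0 | ⟨x₀, hx₀⟩
    · rw [h0, Finset.sum_empty]; positivity
    have hmemR : ∀ x ∈ R, x ∈ S ∧ F x ≠ 0 ∧ G x = g := fun x hx => by
      simpa [hR, and_assoc] using hx
    set h := sharedPart F E B x₀ with hh
    have hshared : ∀ x ∈ R, sharedPart F E B x = h := by
      intro x hx
      refine Finset.lcm_congr rfl fun y hy => ?_
      have := congrFun (congrFun ((hmemR x hx).2.2.trans (hmemR x₀ hx₀).2.2.symm) y) hy
      exact this
    have hpos : 0 < h := sharedPart_pos (hmemR x₀ hx₀).2.1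
    have hpos' : (0 : ℝ) < h := by exact_mod_cast hpos
    have hRS : R ⊆ S := fun x hx => (hmemR x hx).1
    have hcong : ∀ x ∈ R, ∀ x' ∈ R, (h : ℤ) ∣ x - x' := by
      intro x hx x' hx'
      refine Int.natCast_dvd.mpr (Finset.lcm_dvd fun y hy => ?_)
      have e1 := congrFun (congrFun ((hmemR x hx).2.2.trans (hmemR x₀ hx₀).2.2.symm) y) hy
      have e2 := congrFun (congrFun ((hmemR x' hx').2.2.trans (hmemR x₀ hx₀).2.2.symm) y) hy
      have d1 : ((G x₀ y hy : ℕ) : ℤ) ∣ x - y := by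
        rw [← e1]; exact Int.natCast_dvd.mpr (Nat.gcd_dvd_right _ _)
      have d2 : ((G x₀ y hy : ℕ) : ℤ) ∣ x' - y := by
        rw [← e2]; exact Int.natCast_dvd.mpr (Nat.gcd_dvd_right _ _)
      have := dvd_sub d1 d2
      rw [sub_sub_sub_cancel_right] at this
      exact Int.natCast_dvd.mp this
    calc ∑ x ∈ R, revealWeight F E V B x
        ≤ ∑ x ∈ R, (min 1 ((h : ℝ) / V) + (h : ℝ) / strippedValue F E x) := by
          refine Finset.sum_le_sum fun x hx => ?_
          have hs : (0 : ℝ) < strippedValue F E x := by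
            exact_mod_cast strippedValue_pos (hmemR x hx).2.1
          rw [revealWeight, if_neg (hmemR x hx).2.1, hshared x hx]
          rcases le_total (V : ℝ) (strippedValue F E x) with hle | hle
          · rw [min_eq_left hle]
            exact le_add_of_nonneg_right (by positivity)
          · rw [min_eq_right hle]
            exact (min_le_right _ _).trans (le_add_of_nonneg_left (by positivity))
      _ = #R * min 1 ((h : ℝ) / V) + ∑ x ∈ R, (h : ℝ) / strippedValue F E x := by
          rw [Finset.sum_add_distrib, Finset.sum_const, nsmul_eq_mul]
      _ ≤ 3 + T * (D * (1 + Real.log X)) := by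
          refine add_le_add ?_ (sum_div_strippedValue_le hE hpos hRS hX hD hTE
            (fun x hx => (hmemR x hx).2.1)
            fun x hx => hshared x hx ▸ sharedPart_dvd F E B x)
          have hc := card_le_of_pairwise_dvd_sub hpos hRS hcong
          calc (#R : ℝ) * min 1 ((h : ℝ) / V) ≤ (2 * V / h + 1) * min 1 ((h : ℝ) / V) := by
                gcongr
            _ = 2 * V / h * min 1 ((h : ℝ) / V) + min 1 ((h : ℝ) / V) := by ring
            _ ≤ 2 * V / h * ((h : ℝ) / V) + 1 := by
                gcongr
                · exact min_le_right _ _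
                · exact min_le_left _ _
            _ = 3 := by field_simp; norm_num
  refine (Finset.sum_le_sum hfib).trans ?_
  rw [Finset.sum_const, nsmul_eq_mul]
  have hcard : ((#(B'.pi fun y => (F y).natAbs.divisors) : ℕ) : ℝ) ≤ (T : ℝ) ^ n := by
    rw [Finset.card_pi]
    have h1 : ∏ y ∈ B', #(F y).natAbs.divisors ≤ T ^ #B' := by
      rw [← Finset.prod_const]
      refine Finset.prod_le_prod' fun y hy => ?_
      exact hTF y (hB (Finset.mem_filter.mp hy).1) (Finset.mem_filter.mp hy).2
    have h2 : T ^ #B' ≤ T ^ n :=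
      Nat.pow_le_pow_right hT1 ((Finset.card_filter_le _ _).trans hBn)
    exact_mod_cast h1.trans h2
  gcongr

/-- If each factor depends only on the coordinates up to its own, a sum of products over a power
is bounded one coordinate at a time. -/
lemma sum_prod_le_pow_of_sum_le {α : Type*} [Fintype α] (n : ℕ)
    (W : (i : Fin n) → (Fin n → α) → ℝ) (hW : ∀ i v, 0 ≤ W i v)
    (hdep : ∀ i v w, (∀ j ≤ i, v j = w j) → W i v = W i w)
    {Q : ℝ} (hQ : 0 ≤ Q) (hsum : ∀ i v, ∑ x, W i (Function.update v i x) ≤ Q) :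
    ∑ v, ∏ i, W i v ≤ Q ^ n := by
  induction n with
  | zero => simp
  | succ n ih =>
    rcases isEmpty_or_nonempty α with hα | ⟨⟨a⟩⟩
    · rw [Finset.univ_eq_empty, Finset.sum_empty]
      exact pow_nonneg hQ _
    have hsplit : ∑ v, ∏ i, W i v = ∑ u : Fin n → α,
        (∏ i : Fin n, W i.castSucc (Fin.snoc (α := fun _ => α) u a)) *
          ∑ x, W (Fin.last n) (Fin.snoc (α := fun _ => α) u x) := by
      rw [← (Fin.snocEquiv fun _ : Fin (n + 1) => α).sum_comp, Fintype.sum_prod_type,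
        Finset.sum_comm]
      refine Finset.sum_congr rfl fun u _ => ?_
      rw [Finset.mul_sum]
      refine Finset.sum_congr rfl fun x _ => ?_
      rw [Fin.prod_univ_castSucc]
      congr 1
      refine Finset.prod_congr rfl fun i _ => hdep _ _ _ fun j hj => ?_
      have hj' : j ≠ Fin.last n := (lt_of_le_of_lt hj (Fin.castSucc_lt_last i)).ne
      obtain ⟨k, rfl⟩ := Fin.exists_castSucc_eq.mpr hj'
      simp [Fin.snocEquiv]
    rw [hsplit, pow_succ]
    have hlast : ∀ u : Fin n → α, ∑ x, W (Fin.last n) (Fin.snoc (α := fun _ => α) u x) ≤ Q := by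
      intro u
      simpa [Fin.update_snoc_last] using
        hsum (Fin.last n) (Fin.snoc (α := fun _ => α) u a)
    calc _ ≤ ∑ u : Fin n → α,
        (∏ i : Fin n, W i.castSucc (Fin.snoc (α := fun _ => α) u a)) * Q := by
          refine Finset.sum_le_sum fun u _ => ?_
          exact mul_le_mul_of_nonneg_left (hlast u) (Finset.prod_nonneg fun _ _ => hW _ _)
      _ ≤ Q ^ n * Q := by
        rw [← Finset.sum_mul]
        refine mul_le_mul_of_nonneg_right ?_ hQ
        refine ih (fun i u => W i.castSucc (Fin.snoc (α := fun _ => α) u a))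
          (fun _ _ => hW _ _) ?_ ?_
        · intro i v w hvw
          refine hdep _ _ _ fun j hj => ?_
          have hj' : j ≠ Fin.last n := (lt_of_le_of_lt hj (Fin.castSucc_lt_last i)).ne
          obtain ⟨k, rfl⟩ := Fin.exists_castSucc_eq.mpr hj'
          simpa using hvw k (by simpa using hj)
        · intro i v
          simpa [Fin.snoc_update] using hsum i.castSucc (Fin.snoc (α := fun _ => α) v a)

/-- The forward and the backward weights of a coordinate cannot both be small. -/
lemma inv_le_revealWeight_mul {F : ℤ → ℤ} {E V : ℕ} (hV : 1 ≤ V) {B₁ B₂ : Finset ℤ} {x : ℤ}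
    (h : F x ≠ 0 → strippedValue F E x ∣ sharedPart F E (B₁ ∪ B₂) x) :
    (V : ℝ)⁻¹ ≤ revealWeight F E V B₁ x * revealWeight F E V B₂ x := by
  have hV1 : (1 : ℝ) ≤ V := by exact_mod_cast hV
  by_cases hx : F x = 0
  · simp [revealWeight, hx, inv_le_one_of_one_le₀ hV1]
  have hs : 1 ≤ strippedValue F E x := strippedValue_pos hx
  have hb1 : 1 ≤ sharedPart F E B₁ x := sharedPart_pos hx
  have hb2 : 1 ≤ sharedPart F E B₂ x := sharedPart_pos hx
  have hle : strippedValue F E x ≤ sharedPart F E B₁ x * sharedPart F E B₂ x := by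
    refine Nat.le_of_dvd (Nat.mul_pos hb1 hb2) ((h hx).trans ?_)
    refine Finset.lcm_dvd fun y hy => ?_
    obtain ⟨hy, hy0⟩ := Finset.mem_filter.mp hy
    rcases Finset.mem_union.mp hy with hy | hy
    · exact dvd_mul_of_dvd_left (Finset.dvd_lcm (Finset.mem_filter.mpr ⟨hy, hy0⟩)) _
    · exact dvd_mul_of_dvd_right (Finset.dvd_lcm (Finset.mem_filter.mpr ⟨hy, hy0⟩)) _
  rw [revealWeight, revealWeight, if_neg hx, if_neg hx]
  have hs' : (1 : ℝ) ≤ strippedValue F E x := by exact_mod_cast hs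
  have hb1' : (1 : ℝ) ≤ sharedPart F E B₁ x := by exact_mod_cast hb1
  have hb2' : (1 : ℝ) ≤ sharedPart F E B₂ x := by exact_mod_cast hb2
  have hle' : (strippedValue F E x : ℝ) ≤ sharedPart F E B₁ x * sharedPart F E B₂ x := by
    exact_mod_cast hle
  generalize (sharedPart F E B₁ x : ℝ) = a at *
  generalize (sharedPart F E B₂ x : ℝ) = b at *
  generalize (strippedValue F E x : ℝ) = s at *
  have hM1 : 1 ≤ min (V : ℝ) s := le_min hV1 hs'
  have hMV : min (V : ℝ) s ≤ V := min_le_left _ _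
  have hMs : min (V : ℝ) s ≤ s := min_le_right _ _
  generalize min (V : ℝ) s = M at *
  have hM0 : 0 < M := by linarith
  refine (inv_anti₀ hM0 hMV).trans ?_
  have ha : M⁻¹ ≤ a / M := by rw [inv_eq_one_div]; gcongr
  have hb : M⁻¹ ≤ b / M := by rw [inv_eq_one_div]; gcongr
  have h1 : M⁻¹ ≤ 1 := inv_le_one_of_one_le₀ hM1
  rcases min_cases 1 (a / M) with ⟨e1, _⟩ | ⟨e1, _⟩ <;>
    rcases min_cases 1 (b / M) with ⟨e2, _⟩ | ⟨e2, _⟩ <;> rw [e1, e2]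
  · simpa using h1
  · simpa using hb
  · simpa using ha
  · rw [div_mul_div_comm, inv_eq_one_div, div_le_div_iff₀ hM0 (by positivity)]
    nlinarith

/-- Tuples in which every value of `F` is, up to a bounded factor, accounted for by congruences
between the coordinates have essentially only half as many degrees of freedom as coordinates. -/
theorem card_mutually_dividing_le {F : ℤ → ℤ} (hF : ∀ x y, x - y ∣ F x - F y) {E V D T X r : ℕ}
    (hE : E ≠ 0) (hV : 1 ≤ V)
    (hX : ∀ x ∈ Icc (-(V : ℤ)) V, (F x).natAbs ≤ X) (hX1 : 1 ≤ X)
    (hD : ∀ k : ℕ, #{x ∈ Icc (-(V : ℤ)) V | (F x).natAbs = k} ≤ D)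
    (hTE : #E.divisors ≤ T)
    (hTF : ∀ x ∈ Icc (-(V : ℤ)) V, F x ≠ 0 → #(F x).natAbs.divisors ≤ T)
    {A : Finset (Fin (r + r) → ℤ)} (hA : ∀ v ∈ A, ∀ i, v i ∈ Icc (-(V : ℤ)) V)
    (hdvd : ∀ v ∈ A, ∀ i, F (v i) ≠ 0 →
      strippedValue F E (v i) ∣ sharedPart F E ((univ.erase i).image v) (v i)) :
    (#A : ℝ) ≤ 2 * V ^ r * (D + (T : ℝ) ^ (r + r) * (3 + T * (D * (1 + Real.log X)))) ^ (r + r) := by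
  classical
  set Q : ℝ := D + (T : ℝ) ^ (r + r) * (3 + T * (D * (1 + Real.log X))) with hQdef
  have hlog : 0 ≤ Real.log X := Real.log_nonneg (by exact_mod_cast hX1)
  have hQ : 0 ≤ Q := by positivity
  have hV0 : (0 : ℝ) < V := by exact_mod_cast hV
  let α := {x : ℤ // x ∈ Icc (-(V : ℤ)) V}
  let pre : Fin (r + r) → (Fin (r + r) → α) → Finset ℤ := fun i v => (Iio i).image fun j => (v j : ℤ)
  let post : Fin (r + r) → (Fin (r + r) → α) → Finset ℤ :=
    fun i v => (Ioi i).image fun j => (v j : ℤ)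
  let Wf : (Fin (r + r) → α) → ℝ := fun v => ∏ i, revealWeight F E V (pre i v) (v i)
  let Wb : (Fin (r + r) → α) → ℝ := fun v => ∏ i, revealWeight F E V (post i v) (v i)
  have hf0 : ∀ v, 0 ≤ Wf v := fun v => Finset.prod_nonneg fun _ _ => revealWeight_nonneg _ _ _ _ _
  have hb0 : ∀ v, 0 ≤ Wb v := fun v => Finset.prod_nonneg fun _ _ => revealWeight_nonneg _ _ _ _ _
  have hforward : ∑ v, Wf v ≤ Q ^ (r + r) := by
    refine sum_prod_le_pow_of_sum_le (r + r)
      (fun i v => revealWeight F E V (pre i v) (v i)) (fun _ _ => revealWeight_nonneg _ _ _ _ _)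
      ?_ hQ ?_
    · intro i v w hvw
      have : pre i v = pre i w := Finset.image_congr fun j hj => by
        rw [hvw j (Finset.mem_Iio.mp hj).le]
      simp only [this, hvw i le_rfl]
    · intro i v
      have hpre : ∀ x, pre i (Function.update v i x) = pre i v := fun x =>
        Finset.image_congr fun j hj => by
          rw [Function.update_of_ne (Finset.mem_Iio.mp hj).ne]
      simp only [hpre, Function.update_self]
      rw [Finset.univ_eq_attach,
        Finset.sum_attach (Icc (-(V : ℤ)) V) (fun x => revealWeight F E V (pre i v) x)]
      refine sum_revealWeight_le hF hE hV hX hX1 hD hTE hTF ?_ ?_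
      · intro y hy
        obtain ⟨j, -, rfl⟩ := Finset.mem_image.mp hy
        exact (v j).2
      · exact Finset.card_image_le.trans ((Finset.card_le_univ _).trans (by simp))
  have hbackward : ∑ v, Wb v ≤ Q ^ (r + r) := by
    refine le_trans (le_of_eq ?_) hforward
    rw [← (Equiv.arrowCongr Fin.revPerm (Equiv.refl α)).sum_comp]
    refine Finset.sum_congr rfl fun v _ => ?_
    refine Fintype.prod_equiv Fin.revPerm _ _ fun i => ?_
    have : post i ((Equiv.arrowCongr Fin.revPerm (Equiv.refl α)) v) = pre (Fin.revPerm i) v := by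
      ext y
      simp only [post, pre, Finset.mem_image, Finset.mem_Ioi, Finset.mem_Iio]
      constructor
      · rintro ⟨j, hj, rfl⟩
        exact ⟨Fin.rev j, by simpa using hj, rfl⟩
      · rintro ⟨j, hj, rfl⟩
        refine ⟨Fin.rev j, ?_, ?_⟩
        · rw [← Fin.rev_lt_rev]; simpa using hj
        · simp [Equiv.arrowCongr]
    rw [this]
    rfl
  -- The forward and the backward weight of a tuple in `A` have product at least `V ^ (-2r)`.
  have hone : ∀ v : Fin (r + r) → α, (fun i => (v i : ℤ)) ∈ A → 1 ≤ V ^ r * (Wf v + Wb v) := by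
    intro v hv
    have hprod : ((V : ℝ)⁻¹) ^ (r + r) ≤ Wf v * Wb v := by
      simp only [Wf, Wb]
      rw [← Finset.prod_mul_distrib]
      calc ((V : ℝ)⁻¹) ^ (r + r) = ∏ i : Fin (r + r), (V : ℝ)⁻¹ := by simp
        _ ≤ _ := by
          refine Finset.prod_le_prod (fun _ _ => by positivity) fun i _ => ?_
          refine inv_le_revealWeight_mul hV fun h0 => ?_
          have hsplit : pre i v ∪ post i v = (univ.erase i).image fun j => (v j : ℤ) := by
            rw [← Finset.image_union]
            congr 1
            ext j
            simp [lt_or_lt_iff_ne]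
          rw [hsplit]
          exact hdvd _ hv i h0
    have hsq : 1 ≤ (V ^ r * Wf v) * (V ^ r * Wb v) := by
      have : (V : ℝ) ^ (r + r) * ((V : ℝ)⁻¹) ^ (r + r) = 1 := by
        rw [← mul_pow, mul_inv_cancel₀ hV0.ne', one_pow]
      calc (1 : ℝ) = (V : ℝ) ^ (r + r) * ((V : ℝ)⁻¹) ^ (r + r) := this.symm
        _ ≤ (V : ℝ) ^ (r + r) * (Wf v * Wb v) := by gcongr
        _ = _ := by ring
    have p1 : 0 ≤ V ^ r * Wf v := mul_nonneg (by positivity) (hf0 v)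
    have p2 : 0 ≤ V ^ r * Wb v := mul_nonneg (by positivity) (hb0 v)
    nlinarith
  let A' : Finset (Fin (r + r) → α) := univ.filter fun v => (fun i => (v i : ℤ)) ∈ A
  have hcard : #A ≤ #A' := by
    refine Finset.card_le_card_of_injOn (fun v i => if h : v i ∈ Icc (-(V : ℤ)) V then
      (⟨v i, h⟩ : α) else ⟨0, by simp⟩) ?_ ?_
    · intro v hv
      have : (fun i => v i) ∈ A := hv
      simpa [A', hA v hv] using hv
    · intro v hv w hw hvw
      funext i
      have := congrFun hvw i
      simp only [hA v hv i, hA w hw i, dite_true] at this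
      exact congrArg Subtype.val this
  calc (#A : ℝ) ≤ #A' := by exact_mod_cast hcard
    _ = ∑ v ∈ A', (1 : ℝ) := by simp
    _ ≤ ∑ v ∈ A', (V : ℝ) ^ r * (Wf v + Wb v) :=
        Finset.sum_le_sum fun v hv => hone v (Finset.mem_filter.mp hv).2
    _ ≤ ∑ v, (V : ℝ) ^ r * (Wf v + Wb v) :=
        Finset.sum_le_univ_sum_of_nonneg fun v =>
          mul_nonneg (by positivity) (add_nonneg (hf0 v) (hb0 v))
    _ = V ^ r * (∑ v, Wf v + ∑ v, Wb v) := by rw [← Finset.mul_sum, Finset.sum_add_distrib]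
    _ ≤ V ^ r * (Q ^ (r + r) + Q ^ (r + r)) := by gcongr
    _ = 2 * V ^ r * Q ^ (r + r) := by ring

/-! ### The divisor bound -/

/-- The divisor bound: an integer `n` has `n ^ o(1)` divisors. -/
theorem exists_card_divisors_le_rpow {ε : ℝ} (hε : 0 < ε) :
    ∃ C : ℝ, 1 ≤ C ∧ ∀ n : ℕ, n ≠ 0 → (#n.divisors : ℝ) ≤ C * (n : ℝ) ^ ε := by
  have hlog2 : 0 < Real.log 2 := Real.log_pos one_lt_two
  set c : ℝ := max 1 (ε * Real.log 2)⁻¹ with hc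
  have hc1 : 1 ≤ c := le_max_left _ _
  set K : ℕ := ⌈(2 : ℝ) ^ (1 / ε)⌉₊ with hK
  refine ⟨c ^ K, one_le_pow₀ hc1, fun n hn => ?_⟩
  have hprime : ∀ p ∈ n.primeFactors, ((n.factorization p + 1 : ℕ) : ℝ) ≤
      (if p < K then c else 1) * ((p : ℝ) ^ n.factorization p) ^ ε := by
    intro p hp
    have hp2 : (2 : ℝ) ≤ p := by exact_mod_cast (Nat.prime_of_mem_primeFactors hp).two_le
    set a := n.factorization p
    have hswap : ((p : ℝ) ^ a) ^ ε = ((p : ℝ) ^ ε) ^ a := by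
      rw [← Real.rpow_natCast, ← Real.rpow_mul (by positivity), mul_comm,
        Real.rpow_mul (by positivity), Real.rpow_natCast]
    split_ifs with hpK
    · have h1 : 1 + a * (ε * Real.log 2) ≤ ((p : ℝ) ^ a) ^ ε := by
        rw [hswap]
        calc 1 + a * (ε * Real.log 2) ≤ (1 + ε * Real.log 2) ^ a :=
              one_add_mul_le_pow (by have := mul_pos hε hlog2; linarith) a
          _ ≤ ((p : ℝ) ^ ε) ^ a := by
              gcongr
              calc 1 + ε * Real.log 2 ≤ Real.exp (Real.log 2 * ε) := by
                    have := Real.add_one_le_exp (Real.log 2 * ε); linarith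
                _ = (2 : ℝ) ^ ε := (Real.rpow_def_of_pos two_pos ε).symm
                _ ≤ (p : ℝ) ^ ε := Real.rpow_le_rpow two_pos.le hp2 hε.le
      have hinv : 1 ≤ c * (ε * Real.log 2) := by
        have hpos := mul_pos hε hlog2
        calc (1 : ℝ) = (ε * Real.log 2)⁻¹ * (ε * Real.log 2) := (inv_mul_cancel₀ hpos.ne').symm
          _ ≤ c * (ε * Real.log 2) := by gcongr; exact le_max_right _ _
      push_cast
      calc (a : ℝ) + 1 ≤ a * (c * (ε * Real.log 2)) + c := by
            have : (a : ℝ) * 1 ≤ a * (c * (ε * Real.log 2)) := by gcongr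
            linarith
        _ = c * (1 + a * (ε * Real.log 2)) := by ring
        _ ≤ _ := by gcongr
    · have hp2 : (2 : ℝ) ≤ (p : ℝ) ^ ε := by
        have h1 : (2 : ℝ) ^ (1 / ε) ≤ p := (Nat.le_ceil _).trans (by exact_mod_cast not_lt.mp hpK)
        calc (2 : ℝ) = ((2 : ℝ) ^ (1 / ε)) ^ ε := by
              rw [← Real.rpow_mul two_pos.le, one_div_mul_cancel hε.ne', Real.rpow_one]
          _ ≤ _ := Real.rpow_le_rpow (by positivity) h1 hε.le
      rw [hswap, one_mul]
      calc ((a + 1 : ℕ) : ℝ) ≤ ((2 ^ a : ℕ) : ℝ) := by exact_mod_cast Nat.lt_two_pow_self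
        _ = (2 : ℝ) ^ a := by push_cast; rfl
        _ ≤ _ := by gcongr
  rw [Nat.card_divisors hn]
  push_cast
  have hn' : (n : ℝ) ^ ε = ∏ p ∈ n.primeFactors, ((p : ℝ) ^ n.factorization p) ^ ε := by
    conv_lhs => rw [← Nat.prod_factorization_pow_eq_self hn]
    rw [Finsupp.prod, Nat.support_factorization]
    push_cast
    rw [Real.finsetProd_rpow _ _ fun _ _ => by positivity]
  have hsmall : ∏ p ∈ n.primeFactors, (if p < K then c else 1) ≤ c ^ K := by
    rw [Finset.prod_ite, Finset.prod_const, Finset.prod_const_one, mul_one]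
    refine pow_le_pow_right₀ hc1 ?_
    calc #{p ∈ n.primeFactors | p < K} ≤ #(range K) :=
          Finset.card_le_card fun p hp => Finset.mem_range.mpr (Finset.mem_filter.mp hp).2
      _ = K := Finset.card_range K
  calc ∏ p ∈ n.primeFactors, ((n.factorization p : ℝ) + 1)
      ≤ ∏ p ∈ n.primeFactors, ((if p < K then c else 1) * ((p : ℝ) ^ n.factorization p) ^ ε) :=
        Finset.prod_le_prod (fun _ _ => by positivity) fun p hp => by
          have := hprime p hp; push_cast at this; exact this
    _ = (∏ p ∈ n.primeFactors, (if p < K then c else 1)) * (n : ℝ) ^ ε := by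
        rw [Finset.prod_mul_distrib, hn']
    _ ≤ _ := by gcongr

/-! ### Numerators of sums of reciprocals and their p-adic roots -/

/-- The numerator `∑ₗ mₗ ∏_{k ≠ l} (X + k)` of the rational function `∑ₗ mₗ / (X + l)`. -/
noncomputable def reciprocalNum (m : ℤ →₀ ℤ) : ℤ[X] :=
  ∑ u ∈ m.support, C (m u) * ∏ l ∈ m.support.erase u, (X + C l)

lemma aeval_reciprocalNum {R : Type*} [CommRing R] (m : ℤ →₀ ℤ) (z : R) :
    aeval z (reciprocalNum m) =
      ∑ u ∈ m.support, (m u : R) * ∏ l ∈ m.support.erase u, (z + (l : R)) := by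
  simp [reciprocalNum, map_sum, map_prod]

lemma eval_neg_reciprocalNum (m : ℤ →₀ ℤ) {u : ℤ} (hu : u ∈ m.support) :
    (reciprocalNum m).eval (-u) = m u * ∏ l ∈ m.support.erase u, (-u + l) := by
  rw [reciprocalNum, eval_finsetSum, Finset.sum_eq_single_of_mem u hu]
  · simp [eval_prod]
  · intro w _ hw
    rw [eval_mul, eval_prod, Finset.prod_eq_zero (Finset.mem_erase.mpr ⟨hw.symm, hu⟩) (by simp),
      mul_zero]

lemma eval_neg_reciprocalNum_ne_zero (m : ℤ →₀ ℤ) {u : ℤ} (hu : u ∈ m.support) :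
    (reciprocalNum m).eval (-u) ≠ 0 := by
  rw [eval_neg_reciprocalNum m hu]
  refine mul_ne_zero (Finsupp.mem_support_iff.mp hu) (Finset.prod_ne_zero_iff.mpr fun l hl => ?_)
  have := (Finset.mem_erase.mp hl).1
  omega

lemma reciprocalNum_ne_zero {m : ℤ →₀ ℤ} (hm : m ≠ 0) : reciprocalNum m ≠ 0 := by
  obtain ⟨u, hu⟩ := Finsupp.support_nonempty_iff.mpr hm
  intro h
  exact eval_neg_reciprocalNum_ne_zero m hu (by rw [h, eval_zero])

/-- If `∑ mₗ / (z + l)` vanishes at `z` in a nonarchimedean setting and `m_u = ±1`, then `z + u`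
cannot be strictly closest to `0` among the `z + l`. -/
lemma exists_norm_add_le_of_aeval_eq_zero {p : ℕ} [Fact p.Prime] {m : ℤ →₀ ℤ} {u : ℤ}
    (hu : (m u).natAbs = 1) {z : ℤ_[p]} (hz : aeval z (reciprocalNum m) = 0) :
    ∃ l ∈ m.support.erase u, ‖z + (l : ℤ_[p])‖ ≤ ‖z + (u : ℤ_[p])‖ := by
  by_contra! hcon
  have hmem : u ∈ m.support := by
    rw [Finsupp.mem_support_iff]; rintro h; simp [h] at hu
  have hnormu : ‖(m u : ℤ_[p])‖ = 1 := by
    rcases Int.natAbs_eq (m u) with h | h <;> rw [h, hu] <;> simp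
  rw [aeval_reciprocalNum, ← Finset.add_sum_erase _ _ hmem] at hz
  set Pi := ∏ l ∈ m.support.erase u, (z + (l : ℤ_[p])) with hPi
  have hpos : 0 < ‖Pi‖ := by
    rw [hPi, norm_prod]
    exact Finset.prod_pos fun l hl => (norm_nonneg _).trans_lt (hcon l hl)
  have hother : ∀ k ∈ m.support.erase u,
      ‖(m k : ℤ_[p]) * ∏ l ∈ m.support.erase k, (z + (l : ℤ_[p]))‖ < ‖Pi‖ := by
    intro k hk
    obtain ⟨hku, hkm⟩ := Finset.mem_erase.mp hk
    have e1 : ∏ l ∈ m.support.erase k, (z + (l : ℤ_[p])) =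
        (z + (u : ℤ_[p])) * ∏ l ∈ (m.support.erase u).erase k, (z + (l : ℤ_[p])) := by
      rw [Finset.erase_right_comm]
      exact (Finset.mul_prod_erase (m.support.erase k) (fun l => z + (l : ℤ_[p]))
        (Finset.mem_erase.mpr ⟨hku.symm, hmem⟩)).symm
    have e2 : Pi = (z + (k : ℤ_[p])) * ∏ l ∈ (m.support.erase u).erase k, (z + (l : ℤ_[p])) :=
      (Finset.mul_prod_erase _ _ hk).symm
    have hpos' : 0 < ‖∏ l ∈ (m.support.erase u).erase k, (z + (l : ℤ_[p]))‖ := by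
      rw [e2, norm_mul] at hpos
      exact pos_of_mul_pos_right hpos (norm_nonneg _)
    rw [e1, e2, norm_mul, norm_mul, norm_mul]
    calc _ ≤ 1 * (‖z + (u : ℤ_[p])‖ * ‖∏ l ∈ (m.support.erase u).erase k, (z + (l : ℤ_[p]))‖) := by
          gcongr; exact PadicInt.norm_le_one _
      _ < _ := by
          rw [one_mul]
          exact mul_lt_mul_of_pos_right (hcon k hk) hpos'
  have heq : ‖(m u : ℤ_[p]) * Pi‖ = ‖Pi‖ := by rw [norm_mul, hnormu, one_mul]
  rcases (m.support.erase u).eq_empty_or_nonempty with h0 | hne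
  · rw [h0, Finset.sum_empty, add_zero] at hz
    rw [hz, norm_zero] at heq
    exact hpos.ne heq
  · have hlt : ‖∑ k ∈ m.support.erase u,
        (m k : ℤ_[p]) * ∏ l ∈ m.support.erase k, (z + (l : ℤ_[p]))‖ < ‖Pi‖ := by
      obtain ⟨k, hk, hle⟩ := IsUltrametricDist.exists_norm_finsetSum_le_of_nonempty hne
        (fun k => (m k : ℤ_[p]) * ∏ l ∈ m.support.erase k, (z + (l : ℤ_[p])))
      exact hle.trans_lt (hother k hk)
    rw [eq_neg_of_add_eq_zero_left hz, norm_neg] at heq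
    exact hlt.ne heq

/-- If `f` divides the numerator of `∑ mₗ / (X + l)` and `m_u = ±1`, then every prime power dividing
`f (-u)` divides, up to the power of `p` in `E`, one of the differences `u - l`. Here `E` is any
integer that is a combination of `f` and `f'` over `ℤ[X]`. A root of `f` near `-u` is found by Hensel's
lemma. -/
lemma exists_pow_dvd_sub_of_dvd_eval {p : ℕ} [hp : Fact p.Prime] {f : ℤ[X]} {m : ℤ →₀ ℤ}
    (hfm : f ∣ reciprocalNum m) {u : ℤ} (hu : (m u).natAbs = 1) {a b : ℤ[X]} {E : ℤ}
    (hE : f * a + derivative f * b = C E) {e δ : ℕ} (hδ : ¬ (p : ℤ) ^ (δ + 1) ∣ E)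
    (he : (p : ℤ) ^ e ∣ f.eval (-u)) (hlt : 2 * δ < e) :
    ∃ l ∈ m.support.erase u, (p : ℤ) ^ (e - δ) ∣ u - l := by
  have hp1 : (1 : ℝ) < p := by exact_mod_cast hp.out.one_lt
  set w : ℤ_[p] := ((-u : ℤ) : ℤ_[p]) with hw
  have haev : ∀ g : ℤ[X], aeval w g = ((g.eval (-u) : ℤ) : ℤ_[p]) := by
    intro g
    rw [hw, aeval_def, eval₂_at_intCast]
    simp
  have hnf : ‖aeval w f‖ ≤ (p : ℝ) ^ (-(e : ℤ)) := by
    rw [haev]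
    exact (PadicInt.norm_int_le_pow_iff_dvd).mpr (by exact_mod_cast he)
  have hEval : (f.eval (-u)) * a.eval (-u) + (derivative f).eval (-u) * b.eval (-u) = E := by
    have := congrArg (eval (-u)) hE
    simpa using this
  have hnd : (p : ℝ) ^ (-(δ : ℤ)) ≤ ‖aeval w (derivative f)‖ := by
    rw [haev]
    by_contra! hcon
    have h1 : (p : ℤ) ^ (δ + 1) ∣ (derivative f).eval (-u) := by
      have : ‖(((derivative f).eval (-u) : ℤ) : ℤ_[p])‖ ≤ (p : ℝ) ^ (-((δ + 1 : ℕ) : ℤ)) := by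
        rw [PadicInt.norm_le_pow_iff_norm_lt_pow_add_one,
          show -((δ + 1 : ℕ) : ℤ) + 1 = -δ by push_cast; ring]
        exact hcon
      exact_mod_cast (PadicInt.norm_int_le_pow_iff_dvd).mp this
    have h2 : (p : ℤ) ^ (δ + 1) ∣ f.eval (-u) := (pow_dvd_pow _ (by omega)).trans he
    exact hδ (hEval ▸ dvd_add (h2.mul_right _) (h1.mul_right _))
  have hdpos : 0 < ‖aeval w (derivative f)‖ := lt_of_lt_of_le (by positivity) hnd
  have hhensel : ‖aeval w f‖ < ‖aeval w (derivative f)‖ ^ 2 := by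
    calc ‖aeval w f‖ ≤ (p : ℝ) ^ (-(e : ℤ)) := hnf
      _ < (p : ℝ) ^ (-(2 * δ : ℤ)) := zpow_lt_zpow_right₀ hp1 (by omega)
      _ = ((p : ℝ) ^ (-(δ : ℤ))) ^ 2 := by rw [← zpow_natCast, ← zpow_mul]; congr 1; push_cast; ring
      _ ≤ _ := by gcongr
  obtain ⟨z, hz0, hzw, -, -⟩ := hensels_lemma hhensel
  have hzu : ‖z + (u : ℤ_[p])‖ ≤ (p : ℝ) ^ (-((e - δ : ℕ) : ℤ)) := by
    have hzw' : z + (u : ℤ_[p]) = z - w := by rw [hw]; push_cast; ring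
    rw [hzw']
    obtain ⟨k, hk⟩ := binomExpansion (f.map (algebraMap ℤ ℤ_[p])) w (z - w)
    rw [add_sub_cancel, derivative_map, eval_map_algebraMap, eval_map_algebraMap,
      eval_map_algebraMap, hz0] at hk
    have hfz : aeval w f = -((z - w) * (aeval w (derivative f) + k * (z - w))) := by
      linear_combination -hk
    have hnorm : ‖aeval w (derivative f) + k * (z - w)‖ = ‖aeval w (derivative f)‖ := by
      refine PadicInt.norm_add_eq_max_of_ne ?_ |>.trans (max_eq_left ?_)
      all_goals
        have : ‖k * (z - w)‖ < ‖aeval w (derivative f)‖ := by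
          rw [norm_mul]
          exact (mul_le_of_le_one_left (norm_nonneg _) (PadicInt.norm_le_one _)).trans_lt hzw
      · exact this.ne'
      · exact this.le
    have hmul : ‖aeval w f‖ = ‖z - w‖ * ‖aeval w (derivative f)‖ := by
      rw [hfz, norm_neg, norm_mul, hnorm]
    have hppos : (0 : ℝ) < (p : ℝ) ^ (-(δ : ℤ)) := by positivity
    refine le_of_mul_le_mul_right ?_ hppos
    calc ‖z - w‖ * (p : ℝ) ^ (-(δ : ℤ)) ≤ ‖z - w‖ * ‖aeval w (derivative f)‖ := by gcongr
      _ = ‖aeval w f‖ := hmul.symm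
      _ ≤ (p : ℝ) ^ (-(e : ℤ)) := hnf
      _ = _ := by
        rw [← zpow_add₀ (by positivity)]
        congr 1
        push_cast [show δ ≤ e by omega]
        ring
  obtain ⟨g, hg⟩ := hfm
  have hzm : aeval z (reciprocalNum m) = 0 := by rw [hg, map_mul, hz0, zero_mul]
  obtain ⟨l, hl, hle⟩ := exists_norm_add_le_of_aeval_eq_zero hu hzm
  refine ⟨l, hl, ?_⟩
  have : ‖((u - l : ℤ) : ℤ_[p])‖ ≤ (p : ℝ) ^ (-((e - δ : ℕ) : ℤ)) := by
    have e1 : ((u - l : ℤ) : ℤ_[p]) = (z + (u : ℤ_[p])) - (z + (l : ℤ_[p])) := by push_cast; ring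
    rw [e1, sub_eq_add_neg]
    refine (PadicInt.nonarchimedean _ _).trans (max_le hzu ?_)
    rw [norm_neg]
    exact hle.trans hzu
  exact_mod_cast (PadicInt.norm_int_le_pow_iff_dvd).mp this

/-- The local statements at all primes combine: `f (-u)` is, apart from its common divisor with
`E ^ 2`, accounted for by the differences between `u` and the other poles. -/
lemma strippedValue_dvd_sharedPart {f : ℤ[X]} {m : ℤ →₀ ℤ} (hfm : f ∣ reciprocalNum m) {u : ℤ}
    (hu : (m u).natAbs = 1) {a b : ℤ[X]} {E : ℤ} (hE0 : E ≠ 0)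
    (hE : f * a + derivative f * b = C E) {B : Finset ℤ} (hB : m.support.erase u ⊆ B) :
    strippedValue (fun x => f.eval (-x)) (E.natAbs ^ 2) u ∣
      sharedPart (fun x => f.eval (-x)) (E.natAbs ^ 2) B u := by
  set F : ℤ → ℤ := fun x => f.eval (-x) with hF
  have hsupp : ∀ l ∈ m.support, F l ≠ 0 := by
    intro l hl h0
    obtain ⟨g, hg⟩ := hfm
    apply eval_neg_reciprocalNum_ne_zero m hl
    rw [hg, eval_mul]
    have : f.eval (-l) = 0 := h0
    rw [this, zero_mul]
  have humem : u ∈ m.support := by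
    rw [Finsupp.mem_support_iff]; rintro h; simp [h] at hu
  have hN0 : (F u).natAbs ≠ 0 := Int.natAbs_ne_zero.mpr (hsupp u humem)
  have hEn : E.natAbs ≠ 0 := Int.natAbs_ne_zero.mpr hE0
  refine (Nat.dvd_iff_prime_pow_dvd_dvd _ _).mpr fun p k hp hk => ?_
  rcases Nat.eq_zero_or_pos k with rfl | hk0
  · simp
  have : Fact p.Prime := ⟨hp⟩
  have hs0 : strippedValue F (E.natAbs ^ 2) u ≠ 0 := (strippedValue_pos (hsupp u humem)).ne'
  have hg0 : Nat.gcd (F u).natAbs (E.natAbs ^ 2) ≠ 0 := Nat.gcd_ne_zero_left hN0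
  set δ := E.natAbs.factorization p with hδdef
  have hfac : (strippedValue F (E.natAbs ^ 2) u).factorization p +
      min ((F u).natAbs.factorization p) (2 * δ) = (F u).natAbs.factorization p := by
    have h1 := congrArg (fun n => n.factorization p) (strippedValue_mul_gcd F (E.natAbs ^ 2) u)
    simp only [Nat.factorization_mul hs0 hg0, Finsupp.add_apply,
      Nat.factorization_gcd hN0 (pow_ne_zero 2 hEn), Nat.factorization_pow] at h1
    simpa [Finsupp.inf_apply] using h1
  have hk' : k ≤ (strippedValue F (E.natAbs ^ 2) u).factorization p :=
    (hp.pow_dvd_iff_le_factorization hs0).mp hk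
  have he : (p : ℤ) ^ (k + 2 * δ) ∣ f.eval (-u) := by
    have : p ^ (k + 2 * δ) ∣ (F u).natAbs := (hp.pow_dvd_iff_le_factorization hN0).mpr (by omega)
    exact_mod_cast Int.natCast_dvd.mpr this
  have hδ : ¬ (p : ℤ) ^ (δ + 1) ∣ E := by
    intro h
    have : p ^ (δ + 1) ∣ E.natAbs := Int.natCast_dvd.mp (by exact_mod_cast h)
    have := (hp.pow_dvd_iff_le_factorization hEn).mp this
    omega
  obtain ⟨l, hl, hdvd⟩ := exists_pow_dvd_sub_of_dvd_eval hfm hu hE hδ he (by omega)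
  have hdvd' : p ^ k ∣ (u - l).natAbs := by
    apply Int.natCast_dvd.mp
    push_cast
    exact (pow_dvd_pow _ (by omega)).trans hdvd
  exact (Nat.dvd_gcd hk hdvd').trans
    (Finset.dvd_lcm (Finset.mem_filter.mpr ⟨hB hl, hsupp l (Finset.mem_of_mem_erase hl)⟩))

/-! ### Values and common factors of integer polynomials -/

lemma dvd_eval_neg_sub_eval_neg (f : ℤ[X]) (x y : ℤ) : x - y ∣ f.eval (-x) - f.eval (-y) := by
  have := sub_dvd_eval_sub (-x) (-y) f
  rwa [neg_sub_neg, ← neg_sub, neg_dvd] at this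

lemma card_natAbs_eval_eq_le {f : ℤ[X]} (hf : 0 < f.natDegree) (S : Finset ℤ) (k : ℕ) :
    #{x ∈ S | (f.eval (-x)).natAbs = k} ≤ 2 * f.natDegree := by
  classical
  have hmaps : Set.MapsTo (fun x : ℤ => -x) ({x ∈ S | (f.eval (-x)).natAbs = k} : Finset ℤ)
      (((f - C (k : ℤ)).roots.toFinset ∪ (f + C (k : ℤ)).roots.toFinset : Finset ℤ) : Set ℤ) := by
    intro x hx
    have hx' : (f.eval (-x)).natAbs = k := (Finset.mem_filter.mp hx).2
    have h1 : f - C (k : ℤ) ≠ 0 := by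
      intro h
      have := natDegree_sub_C (p := f) (a := (k : ℤ))
      rw [h, natDegree_zero] at this
      omega
    have h2 : f + C (k : ℤ) ≠ 0 := by
      intro h
      have := natDegree_add_C (p := f) (a := (k : ℤ))
      rw [h, natDegree_zero] at this
      omega
    simp only [Finset.coe_union, Set.mem_union, Finset.mem_coe, Multiset.mem_toFinset,
      mem_roots h1, mem_roots h2, IsRoot, eval_sub, eval_add, eval_C]
    omega
  refine (Finset.card_le_card_of_injOn _ hmaps neg_injective.injOn).trans ?_
  refine (Finset.card_union_le _ _).trans ?_
  have h1 : #(f - C (k : ℤ)).roots.toFinset ≤ f.natDegree :=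
    (Multiset.toFinset_card_le _).trans ((card_roots' _).trans natDegree_sub_C.le)
  have h2 : #(f + C (k : ℤ)).roots.toFinset ≤ f.natDegree :=
    (Multiset.toFinset_card_le _).trans ((card_roots' _).trans natDegree_add_C.le)
  omega

/-- Two integer polynomials with vanishing resultant share one of the finitely many nonconstant
prime factors of the first. -/
lemma exists_common_factor_of_resultant_eq_zero {P Q : ℤ[X]} (hP : P ≠ 0)
    (h : resultant P Q = 0) :
    ∃ f ∈ UniqueFactorizationMonoid.normalizedFactors P, 0 < f.natDegree ∧ f ∣ Q := by
  have hinj : Function.Injective (algebraMap ℤ ℚ) := (algebraMap ℤ ℚ).injective_int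
  have hres : resultant (P.map (algebraMap ℤ ℚ)) (Q.map (algebraMap ℤ ℚ)) = 0 := by
    rw [resultant_map_map, natDegree_map_eq_of_injective hinj, natDegree_map_eq_of_injective hinj,
      h, map_zero]
  have hP' : P.map (algebraMap ℤ ℚ) ≠ 0 := (Polynomial.map_ne_zero_iff hinj).mpr hP
  obtain ⟨g, hg, hgP, hgQ⟩ : ∃ g : ℚ[X], Irreducible g ∧ g ∣ P.map (algebraMap ℤ ℚ) ∧
      g ∣ Q.map (algebraMap ℤ ℚ) := by
    by_contra! hcon
    exact (resultant_eq_zero_iff.mp hres).2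
      (isCoprime_of_irreducible_dvd (fun h => hP' h.1) fun z hz h1 h2 => hcon z hz h1 h2)
  have hassoc := UniqueFactorizationMonoid.prod_normalizedFactors hP
  have hgprod : g ∣ ((UniqueFactorizationMonoid.normalizedFactors P).map
      (mapRingHom (algebraMap ℤ ℚ))).prod := by
    rw [Multiset.prod_hom]
    exact hgP.trans (map_dvd (mapRingHom (algebraMap ℤ ℚ)) hassoc.symm.dvd)
  obtain ⟨f', hf', hgf⟩ := hg.prime.exists_mem_multiset_dvd hgprod
  obtain ⟨f, hf, rfl⟩ := Multiset.mem_map.mp hf'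
  have hirr := UniqueFactorizationMonoid.irreducible_of_normalized_factor f hf
  rw [coe_mapRingHom] at hgf
  have hdeg : 0 < f.natDegree := by
    by_contra h0
    obtain ⟨c, rfl⟩ : ∃ c, f = C c := ⟨_, eq_C_of_natDegree_eq_zero (by omega)⟩
    have hc : c ≠ 0 := by rintro rfl; simp at hirr
    rw [map_C] at hgf
    refine hg.not_isUnit (isUnit_of_dvd_unit hgf (isUnit_C.mpr ?_))
    exact isUnit_iff_ne_zero.mpr (by simpa using hc)
  have hprim := hirr.isPrimitive hdeg.ne'
  refine ⟨f, hf, hdeg, hprim.dvd_of_fraction_map_dvd_fraction_map (K := ℚ) ?_⟩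
  have hirr' : Irreducible (f.map (algebraMap ℤ ℚ)) :=
    hprim.irreducible_iff_irreducible_map_fraction_map.mp hirr
  exact (hg.associated_of_dvd hirr' hgf).symm.dvd.trans hgQ

lemma resultant_derivative_ne_zero {f : ℤ[X]} (hf : Irreducible f) (hdeg : 0 < f.natDegree) :
    resultant f (derivative f) ≠ 0 := by
  have hinj : Function.Injective (algebraMap ℤ ℚ) := (algebraMap ℤ ℚ).injective_int
  have hirr : Irreducible (f.map (algebraMap ℤ ℚ)) :=
    (hf.isPrimitive hdeg.ne').irreducible_iff_irreducible_map_fraction_map.mp hf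
  have h := resultant_ne_zero _ _ hirr.separable
  rw [derivative_map, resultant_map_map, natDegree_map_eq_of_injective hinj,
    natDegree_map_eq_of_injective hinj] at h
  exact fun h0 => h (by rw [h0, map_zero])

/-! ### Bounds for coefficients and resultants -/

lemma abs_coeff_prod_X_add_C_mul_pow_le {V : ℤ} (hV : 0 ≤ V) (s : Finset ℤ)
    (hs : ∀ l ∈ s, |l| ≤ V) (k : ℕ) :
    |(∏ l ∈ s, (X + C l : ℤ[X])).coeff k| * V ^ k ≤ (2 * V) ^ #s := by
  induction s using Finset.induction_on generalizing k with
  | empty =>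
    rcases k with _ | k <;> simp [coeff_one]
  | insert l s hl ih =>
    have ih' := ih fun x hx => hs x (Finset.mem_insert_of_mem hx)
    have hlV := hs l (Finset.mem_insert_self _ _)
    rw [Finset.prod_insert hl, Finset.card_insert_of_notMem hl, pow_succ]
    set P := ∏ l ∈ s, (X + C l : ℤ[X])
    have hterm : |l * P.coeff k| * V ^ k ≤ V * (2 * V) ^ #s := by
      rw [abs_mul, mul_assoc]
      exact mul_le_mul hlV (ih' k) (by positivity) hV
    rcases k with _ | k
    · rw [add_mul, coeff_add, mul_coeff_zero, coeff_X_zero, zero_mul, zero_add, coeff_C_mul]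
      refine hterm.trans ?_
      have : 0 ≤ (2 * V) ^ #s := by positivity
      nlinarith
    · rw [add_mul, coeff_add, coeff_X_mul, coeff_C_mul]
      calc |P.coeff k + l * P.coeff (k + 1)| * V ^ (k + 1)
          ≤ (|P.coeff k| + |l * P.coeff (k + 1)|) * V ^ (k + 1) := by
            gcongr; exact abs_add_le _ _
        _ = |P.coeff k| * V ^ k * V + |l * P.coeff (k + 1)| * V ^ (k + 1) := by ring
        _ ≤ (2 * V) ^ #s * V + V * (2 * V) ^ #s := by
            gcongr
            exact ih' k
        _ = (2 * V) ^ #s * (2 * V) := by ring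

lemma abs_coeff_reciprocalNum_mul_pow_le {V : ℤ} (hV : 1 ≤ V) {m : ℤ →₀ ℤ}
    (hm : ∀ l ∈ m.support, |l| ≤ V) {S : ℕ} (hS : #m.support ≤ S + 1) (k : ℕ) :
    |(reciprocalNum m).coeff k| * V ^ k ≤ (∑ u ∈ m.support, |m u|) * (2 * V) ^ S := by
  rw [reciprocalNum, finsetSum_coeff]
  calc |∑ u ∈ m.support, (C (m u) * ∏ l ∈ m.support.erase u, (X + C l)).coeff k| * V ^ k
      ≤ (∑ u ∈ m.support, |(C (m u) * ∏ l ∈ m.support.erase u, (X + C l)).coeff k|) * V ^ k := by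
        gcongr; exact Finset.abs_sum_le_sum_abs _ _
    _ ≤ ∑ u ∈ m.support, |m u| * (2 * V) ^ S := by
        rw [Finset.sum_mul]
        refine Finset.sum_le_sum fun u hu => ?_
        rw [coeff_C_mul, abs_mul, mul_assoc]
        gcongr
        refine (abs_coeff_prod_X_add_C_mul_pow_le (by omega) _
          (fun l hl => hm l (Finset.mem_of_mem_erase hl)) k).trans ?_
        refine pow_le_pow_right₀ (by omega) ?_
        rw [Finset.card_erase_of_mem hu]
        omega
    _ = _ := by rw [Finset.sum_mul]

/-- The leading terms cancel when the multiplicities sum to `0`. -/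
lemma natDegree_reciprocalNum_le {m : ℤ →₀ ℤ} (h0 : ∑ u ∈ m.support, m u = 0) :
    (reciprocalNum m).natDegree ≤ #m.support - 2 := by
  rw [natDegree_le_iff_coeff_eq_zero]
  intro N hN
  rw [reciprocalNum, finsetSum_coeff]
  have hcard : ∀ u ∈ m.support, #(m.support.erase u) = #m.support - 1 :=
    fun u hu => Finset.card_erase_of_mem hu
  have hdeg : ∀ u ∈ m.support,
      (∏ l ∈ m.support.erase u, (X + C l : ℤ[X])).natDegree = #m.support - 1 := by
    intro u hu
    rw [natDegree_prod_of_monic _ _ fun l _ => monic_X_add_C l,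
      Finset.sum_congr rfl fun l _ => natDegree_X_add_C l, Finset.sum_const, hcard u hu,
      smul_eq_mul, mul_one]
  rcases Nat.lt_or_ge (#m.support - 1) N with h | h
  · refine Finset.sum_eq_zero fun u hu => ?_
    rw [coeff_C_mul, coeff_eq_zero_of_natDegree_lt (by rw [hdeg u hu]; exact h), mul_zero]
  · rw [← h0]
    refine Finset.sum_congr rfl fun u hu => ?_
    have hNeq : N = (∏ l ∈ m.support.erase u, (X + C l : ℤ[X])).natDegree := by
      rw [hdeg u hu]; omega
    rw [coeff_C_mul, hNeq, (monic_prod_of_monic _ _ fun l _ => monic_X_add_C l).coeff_natDegree,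
      mul_one]

/-- A bound for the resultant that takes into account that the coefficients of the two polynomials
shrink geometrically with the degree. -/
lemma abs_resultant_le {P Q : ℤ[X]} {V c : ℤ} {S : ℕ} (hV : 1 ≤ V) (hc : 1 ≤ c)
    (hPdeg : P.natDegree < S) (hQdeg : Q.natDegree < S)
    (hP : ∀ k, |P.coeff k| * V ^ k ≤ c * V ^ S) (hQ : ∀ k, |Q.coeff k| * V ^ k ≤ c * V ^ S) :
    |resultant P Q| ≤ (2 * S).factorial * c ^ (2 * S) * V ^ (S ^ 2 - 1) := by
  set m := P.natDegree with hm
  set n := Q.natDegree with hn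
  have hV0 : 0 < V := by omega
  -- The entry in row `i` and column `j₁` of either block is a coefficient of index `i - j₁`.
  have hentry : ∀ i j : Fin (m + n), |sylvester P Q m n i j| * V ^ (i : ℕ) ≤
      c * V ^ S * V ^ (j.addCases (fun j₁ => (j₁ : ℕ)) (fun j₁ => (j₁ : ℕ)) : ℕ) := by
    intro i j
    induction j using Fin.addCases with
    | left j₁ =>
      simp only [sylvester, Matrix.of_apply, Fin.addCases_left]
      split_ifs with h
      · have hi : (i : ℕ) = (i - j₁) + j₁ := by have := h.1; omega
        calc _ = |Q.coeff (i - j₁)| * V ^ ((i : ℕ) - j₁) * V ^ (j₁ : ℕ) := by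
              rw [mul_assoc, ← pow_add, ← hi]
          _ ≤ _ := mul_le_mul_of_nonneg_right (hQ _) (by positivity)
      · rw [abs_zero, zero_mul]; positivity
    | right j₁ =>
      simp only [sylvester, Matrix.of_apply, Fin.addCases_right]
      split_ifs with h
      · have hi : (i : ℕ) = (i - j₁) + j₁ := by have := h.1; omega
        calc _ = |P.coeff (i - j₁)| * V ^ ((i : ℕ) - j₁) * V ^ (j₁ : ℕ) := by
              rw [mul_assoc, ← pow_add, ← hi]
          _ ≤ _ := mul_le_mul_of_nonneg_right (hP _) (by positivity)
      · rw [abs_zero, zero_mul]; positivity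
  have hexp : S * (m + n) ≤ S ^ 2 - 1 + m * n := by
    obtain ⟨a, ha⟩ := Nat.exists_eq_add_of_lt hPdeg
    obtain ⟨b, hb⟩ := Nat.exists_eq_add_of_lt hQdeg
    have h1 : (S - m) * (S - n) ≥ 1 := Nat.mul_pos (by omega) (by omega)
    have h2 : S ^ 2 ≥ 1 := Nat.one_le_pow _ _ (by omega)
    zify [hPdeg.le, hQdeg.le, h2] at *
    nlinarith
  set A : ℕ := ∑ j : Fin (m + n),
    (j.addCases (fun j₁ => (j₁ : ℕ)) (fun j₁ => (j₁ : ℕ)) : ℕ) with hA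
  have hsum : ∑ i : Fin (m + n), (i : ℕ) = A + m * n := by
    rw [hA, Fin.sum_univ_add, Fin.sum_univ_add]
    simp only [Fin.addCases_left, Fin.addCases_right, Fin.val_castAdd, Fin.val_natAdd,
      Finset.sum_add_distrib, Finset.sum_const, Finset.card_univ, Fintype.card_fin, smul_eq_mul]
    ring
  have hperm : ∀ σ : Equiv.Perm (Fin (m + n)),
      |∏ j, sylvester P Q m n (σ j) j| ≤ c ^ (2 * S) * V ^ (S ^ 2 - 1) := by
    intro σ
    have h1 : (∏ j, |sylvester P Q m n (σ j) j|) * V ^ (A + m * n) ≤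
        (c * V ^ S) ^ (m + n) * V ^ A := by
      calc (∏ j, |sylvester P Q m n (σ j) j|) * V ^ (A + m * n)
          = ∏ j, (|sylvester P Q m n (σ j) j| * V ^ (σ j : ℕ)) := by
            rw [Finset.prod_mul_distrib, Finset.prod_pow_eq_pow_sum,
              Equiv.sum_comp σ fun i => (i : ℕ), hsum]
        _ ≤ ∏ j : Fin (m + n), (c * V ^ S *
            V ^ (j.addCases (fun j₁ => (j₁ : ℕ)) (fun j₁ => (j₁ : ℕ)) : ℕ)) :=
            Finset.prod_le_prod (fun _ _ => by positivity) fun j _ => hentry (σ j) j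
        _ = _ := by
            rw [Finset.prod_mul_distrib, Finset.prod_pow_eq_pow_sum, Finset.prod_const,
              Finset.card_univ, Fintype.card_fin]
    have h2 : (∏ j, |sylvester P Q m n (σ j) j|) * V ^ (m * n) ≤ (c * V ^ S) ^ (m + n) := by
      have hpos : 0 < V ^ A := by positivity
      refine le_of_mul_le_mul_right ?_ hpos
      calc _ = (∏ j, |sylvester P Q m n (σ j) j|) * V ^ (A + m * n) := by rw [pow_add]; ring
        _ ≤ _ := h1
    have hpos : 0 < V ^ (m * n) := by positivity
    rw [Finset.abs_prod]
    refine le_of_mul_le_mul_right (h2.trans ?_) hpos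
    calc (c * V ^ S) ^ (m + n) = c ^ (m + n) * V ^ (S * (m + n)) := by rw [mul_pow, ← pow_mul]
      _ ≤ c ^ (2 * S) * V ^ (S ^ 2 - 1 + m * n) := by
          gcongr
          omega
      _ = _ := by rw [pow_add]; ring
  rw [resultant, Matrix.det_apply]
  calc |∑ σ : Equiv.Perm (Fin (m + n)), Equiv.Perm.sign σ • ∏ j, sylvester P Q m n (σ j) j|
      ≤ ∑ σ : Equiv.Perm (Fin (m + n)), |Equiv.Perm.sign σ • ∏ j, sylvester P Q m n (σ j) j| :=
        Finset.abs_sum_le_sum_abs _ _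
    _ ≤ ∑ σ : Equiv.Perm (Fin (m + n)), c ^ (2 * S) * V ^ (S ^ 2 - 1) := by
        refine Finset.sum_le_sum fun σ _ => ?_
        have : |Equiv.Perm.sign σ • ∏ j, sylvester P Q m n (σ j) j| =
            |∏ j, sylvester P Q m n (σ j) j| := by
          rcases Int.units_eq_one_or (Equiv.Perm.sign σ) with h | h <;> simp [h]
        rw [this]
        exact hperm σ
    _ = (m + n).factorial * (c ^ (2 * S) * V ^ (S ^ 2 - 1)) := by
        rw [Finset.sum_const, Finset.card_univ, Fintype.card_perm, Fintype.card_fin, nsmul_eq_mul]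
    _ ≤ (2 * S).factorial * (c ^ (2 * S) * V ^ (S ^ 2 - 1)) := by
        gcongr
        omega
    _ = _ := by ring

/-- Factors of an integer polynomial have coefficients of comparable size. -/
lemma abs_coeff_le_of_dvd {f P : ℤ[X]} (hP : P ≠ 0) (hf : f ∣ P) {d : ℕ} (hd : P.natDegree ≤ d)
    {c : ℝ} (hc : ∀ k, |(P.coeff k : ℝ)| ≤ c) (k : ℕ) :
    |(f.coeff k : ℝ)| ≤ 2 ^ d * ((d + 1) * c) := by
  obtain ⟨h, rfl⟩ := hf
  have hf0 : f ≠ 0 := left_ne_zero_of_mul hP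
  have hh0 : h ≠ 0 := right_ne_zero_of_mul hP
  have hc0 : 0 ≤ c := (abs_nonneg _).trans (hc 0)
  have hinj : Function.Injective (Int.castRingHom ℂ) := Int.cast_injective
  have hfd : f.natDegree ≤ d := (natDegree_le_of_dvd (Dvd.intro _ rfl) hP).trans hd
  have hmh : 1 ≤ (h.map (Int.castRingHom ℂ)).mahlerMeasure := by
    refine one_le_mahlerMeasure_of_one_le_norm_leadingCoeff ?_
    rw [leadingCoeff_map_of_injective hinj]
    have : (1 : ℤ) ≤ |h.leadingCoeff| := Int.one_le_abs (leadingCoeff_ne_zero.mpr hh0)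
    simp only [eq_intCast, Complex.norm_intCast]
    exact_mod_cast this
  have key := norm_coeff_le_choose_mul_mahlerMeasure_of_one_le_mahlerMeasure k
    (f.map (Int.castRingHom ℂ)) (h.map (Int.castRingHom ℂ)) hmh
  rw [coeff_map, ← Polynomial.map_mul, natDegree_map_eq_of_injective hinj] at key
  simp only [eq_intCast, Complex.norm_intCast] at key
  have hsum : ((f * h).map (Int.castRingHom ℂ)).mahlerMeasure ≤ (d + 1) * c := by
    refine (mahlerMeasure_le_sum_norm_coeff _).trans ?_
    rw [sum_over_range' _ (fun _ => norm_zero) (d + 1)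
      (by rw [natDegree_map_eq_of_injective hinj]; omega)]
    calc ∑ i ∈ range (d + 1), ‖((f * h).map (Int.castRingHom ℂ)).coeff i‖
        ≤ ∑ i ∈ range (d + 1), c := by
          refine Finset.sum_le_sum fun i _ => ?_
          rw [coeff_map]
          simp only [eq_intCast, Complex.norm_intCast]
          exact hc i
      _ = _ := by simp
  refine key.trans ?_
  have hchoose : ((f.natDegree.choose k : ℕ) : ℝ) ≤ 2 ^ d := by
    have : f.natDegree.choose k ≤ 2 ^ d :=
      (Nat.choose_le_two_pow _ _).trans (Nat.pow_le_pow_right two_pos hfd)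
    exact_mod_cast this
  exact mul_le_mul hchoose hsum (mahlerMeasure_nonneg _) (by positivity)

/-! ### Tuples whose numerators share a factor -/

/-- The finitely supported function `∑ᵢ sᵢ δ_{wᵢ}`, which collects the terms of
`∑ᵢ sᵢ / (X + wᵢ)` with equal denominators. -/
noncomputable def signedCount {ι : Type*} [Fintype ι] (s w : ι → ℤ) : ℤ →₀ ℤ :=
  ∑ i, Finsupp.single (w i) (s i)

section signedCount

variable {ι : Type*} [Fintype ι] (s w : ι → ℤ)

lemma signedCount_apply (u : ℤ) : signedCount s w u = ∑ i with w i = u, s i := by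
  classical
  rw [signedCount, Finsupp.finsetSum_apply, Finset.sum_filter]
  exact Finset.sum_congr rfl fun i _ => by rw [Finsupp.single_apply]

lemma support_signedCount_subset :
    (signedCount s w).support ⊆ univ.image w := by
  intro u hu
  by_contra hcon
  refine Finsupp.mem_support_iff.mp hu ?_
  rw [signedCount_apply]
  refine Finset.sum_eq_zero fun i hi => absurd ?_ hcon
  exact Finset.mem_image.mpr ⟨i, mem_univ i, (Finset.mem_filter.mp hi).2⟩

lemma card_support_signedCount_le : #(signedCount s w).support ≤ Fintype.card ι := by
  classical
  exact (Finset.card_le_card (support_signedCount_subset s w)).trans Finset.card_image_le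

lemma sum_signedCount_mul {R : Type*} [CommRing R] (g : ℤ → R) :
    ∑ u ∈ (signedCount s w).support, (signedCount s w u : R) * g u =
      ∑ i, (s i : R) * g (w i) := by
  have h1 : Finsupp.linearCombination ℤ g (signedCount s w) = ∑ i, (s i : R) * g (w i) := by
    rw [signedCount, map_sum]
    exact Finset.sum_congr rfl fun i _ => by
      rw [Finsupp.linearCombination_single, zsmul_eq_mul]
  rw [← h1, Finsupp.linearCombination_apply, Finsupp.sum]
  exact Finset.sum_congr rfl fun u _ => (zsmul_eq_mul _ _).symm

lemma sum_signedCount : ∑ u ∈ (signedCount s w).support, signedCount s w u = ∑ i, s i := by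
  simpa using sum_signedCount_mul s w (fun _ => (1 : ℤ))

variable {s} in
lemma sum_abs_signedCount_le (hs : ∀ i, |s i| = 1) :
    ∑ u ∈ (signedCount s w).support, |signedCount s w u| ≤ Fintype.card ι := by
  classical
  calc ∑ u ∈ (signedCount s w).support, |signedCount s w u|
      ≤ ∑ u ∈ (signedCount s w).support, ((#{i | w i = u} : ℕ) : ℤ) := by
        refine Finset.sum_le_sum fun u _ => ?_
        rw [signedCount_apply]
        refine (Finset.abs_sum_le_sum_abs _ _).trans (le_of_eq ?_)
        rw [Finset.sum_congr rfl fun i _ => hs i]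
        simp
    _ ≤ Fintype.card ι := by
        have hle : ∑ u ∈ (signedCount s w).support, #{i | w i = u} ≤ Fintype.card ι :=
          (Finset.sum_card_fiberwise_eq_card_filter _ _ _).trans_le (Finset.card_le_univ _)
        exact_mod_cast hle

lemma signedCount_apply_of_unique [DecidableEq ι] {i : ι} (hi : ∀ j, j ≠ i → w j ≠ w i) :
    signedCount s w (w i) = s i := by
  rw [signedCount_apply, Finset.sum_filter, Finset.sum_eq_single i]
  · simp
  · intro j _ hj
    rw [if_neg (hi j hj)]
  · simp

end signedCount

/-- If `f` divides the numerator of `∑ᵢ sᵢ / (X + wᵢ)`, or this sum vanishes identically, then each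
value `f (-wᵢ)` is essentially accounted for by congruences between `wᵢ` and the other `wⱼ`.
For a repeated `wᵢ` this is trivial. -/
lemma strippedValue_dvd_sharedPart_of_signedCount {ι : Type*} [Fintype ι] [DecidableEq ι]
    {s w : ι → ℤ} (hs : ∀ i, |s i| = 1) {f : ℤ[X]}
    (hf : signedCount s w = 0 ∨ f ∣ reciprocalNum (signedCount s w))
    {a b : ℤ[X]} {E : ℤ} (hE0 : E ≠ 0) (hE : f * a + derivative f * b = C E) (i : ι)
    (hi0 : f.eval (-w i) ≠ 0) :
    strippedValue (fun x => f.eval (-x)) (E.natAbs ^ 2) (w i) ∣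
      sharedPart (fun x => f.eval (-x)) (E.natAbs ^ 2) ((univ.erase i).image w) (w i) := by
  by_cases hrep : ∃ j, j ≠ i ∧ w j = w i
  · obtain ⟨j, hji, hj⟩ := hrep
    have hmem : w i ∈ ((univ.erase i).image w).filter (fun x => f.eval (-x) ≠ 0) :=
      Finset.mem_filter.mpr
        ⟨Finset.mem_image.mpr ⟨j, Finset.mem_erase.mpr ⟨hji, mem_univ j⟩, hj⟩, hi0⟩
    refine dvd_trans ?_ (Finset.dvd_lcm hmem)
    rw [sub_self, Int.natAbs_zero, Nat.gcd_zero_right]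
  · push Not at hrep
    have hval := signedCount_apply_of_unique s w hrep
    have habs : (signedCount s w (w i)).natAbs = 1 := by
      rw [hval]
      zify
      exact hs i
    rcases hf with h0 | hdvd
    · rw [h0] at habs; simp at habs
    · refine strippedValue_dvd_sharedPart hdvd habs hE0 hE fun u hu => ?_
      obtain ⟨hui, hu⟩ := Finset.mem_erase.mp hu
      obtain ⟨j, -, rfl⟩ := Finset.mem_image.mp (support_signedCount_subset s w hu)
      exact Finset.mem_image.mpr
        ⟨j, Finset.mem_erase.mpr ⟨fun h => hui (by rw [h]), mem_univ j⟩, rfl⟩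

lemma natAbs_eval_neg_le {f : ℤ[X]} {d c V : ℕ} (hV : 1 ≤ V) (hd : f.natDegree ≤ d)
    (hc : ∀ k, |f.coeff k| ≤ c) {x : ℤ} (hx : x ∈ Icc (-(V : ℤ)) V) :
    (f.eval (-x)).natAbs ≤ (d + 1) * c * V ^ d := by
  have hx' : |-x| ≤ V := by rw [abs_neg]; exact abs_le.mpr (Finset.mem_Icc.mp hx)
  have hV' : (1 : ℤ) ≤ V := by exact_mod_cast hV
  have : |f.eval (-x)| ≤ (d + 1) * c * V ^ d := by
    rw [eval_eq_sum_range' (Nat.lt_succ_of_le hd)]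
    calc |∑ i ∈ range (d + 1), f.coeff i * (-x) ^ i|
        ≤ ∑ i ∈ range (d + 1), |f.coeff i * (-x) ^ i| := Finset.abs_sum_le_sum_abs _ _
      _ ≤ ∑ i ∈ range (d + 1), (c * V ^ d : ℤ) := by
          refine Finset.sum_le_sum fun i hi => ?_
          rw [abs_mul, abs_pow]
          have h1 : |-x| ^ i ≤ (V : ℤ) ^ d :=
            (pow_le_pow_left₀ (abs_nonneg _) hx' i).trans
              (pow_le_pow_right₀ hV' (Nat.lt_succ_iff.mp (Finset.mem_range.mp hi)))
          exact mul_le_mul (hc i) h1 (by positivity) (by positivity)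
      _ = _ := by simp [mul_assoc]
  zify
  exact this

/-- The bound of `card_mutually_dividing_le` is `O(V ^ ε)` once `X` and the number `T` of divisors
are controlled by a sufficiently small power of a fixed power of `V`. -/
lemma exists_pow_bound (n D : ℕ) (K M : ℕ) (hM : 1 ≤ M) {ε : ℝ} (hε : 0 < ε) :
    ∃ δ : ℝ, 0 < δ ∧ ∀ C : ℝ, 1 ≤ C → ∃ A : ℝ, 0 < A ∧ ∀ V T X : ℕ, 1 ≤ V → 1 ≤ X →
      X ≤ M * V ^ K → (T : ℝ) ≤ C * ((M : ℝ) * V ^ K) ^ δ →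
      (D + (T : ℝ) ^ n * (3 + T * (D * (1 + Real.log X)))) ^ n ≤ A * (V : ℝ) ^ ε := by
  refine ⟨ε / (K * ((n + 2) * n) + 1), by positivity, fun C hC => ?_⟩
  set δ : ℝ := ε / (K * ((n + 2) * n) + 1) with hδ
  have hδ0 : 0 < δ := by positivity
  have hM0 : (0 : ℝ) < M := by exact_mod_cast hM
  set t : ℝ := C * (M : ℝ) ^ δ with ht
  set g : ℝ := 1 + (M : ℝ) ^ δ / δ with hg
  set Q₀ : ℝ := D + t ^ n * (3 + t * (D * g)) with hQ₀
  refine ⟨Q₀ ^ n + 1, by positivity, fun V T X hV hX1 hX hT => ?_⟩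
  have hV1 : (1 : ℝ) ≤ V := by exact_mod_cast hV
  have hV0 : (0 : ℝ) < V := by linarith
  set Y : ℝ := (V : ℝ) ^ (K * δ) with hY
  have hY1 : 1 ≤ Y := Real.one_le_rpow hV1 (by positivity)
  have hY0 : 0 < Y := by linarith
  have hMY : ((M : ℝ) * V ^ K) ^ δ = (M : ℝ) ^ δ * Y := by
    rw [Real.mul_rpow hM0.le (by positivity), ← Real.rpow_natCast, ← Real.rpow_mul hV0.le]
  have hT' : (T : ℝ) ≤ t * Y := by rw [hMY] at hT; rw [ht, mul_assoc]; exact hT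
  have hlog0 : 0 ≤ Real.log X := Real.log_nonneg (by exact_mod_cast hX1)
  have hlog : 1 + Real.log X ≤ g * Y := by
    have h1 : Real.log X ≤ (X : ℝ) ^ δ / δ := Real.log_le_rpow_div (by positivity) hδ0
    have h2 : (X : ℝ) ^ δ ≤ (M : ℝ) ^ δ * Y := by
      rw [← hMY]
      exact Real.rpow_le_rpow (by positivity) (by exact_mod_cast hX) hδ0.le
    have h3 : (X : ℝ) ^ δ / δ ≤ (M : ℝ) ^ δ * Y / δ := by gcongr
    rw [hg, add_mul, one_mul, div_mul_eq_mul_div]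
    linarith
  have hQ : D + (T : ℝ) ^ n * (3 + T * (D * (1 + Real.log X))) ≤ Q₀ * Y ^ (n + 2) := by
    have hYn : 1 ≤ Y ^ (n + 2) := one_le_pow₀ hY1
    have hY2 : 1 ≤ Y ^ 2 := one_le_pow₀ hY1
    calc D + (T : ℝ) ^ n * (3 + T * (D * (1 + Real.log X)))
        ≤ D * Y ^ (n + 2) + (t * Y) ^ n * (3 * Y ^ 2 + (t * Y) * (D * (g * Y))) := by
          have hD : (D : ℝ) ≤ D * Y ^ (n + 2) := le_mul_of_one_le_right (by positivity) hYn
          have h3 : (3 : ℝ) ≤ 3 * Y ^ 2 := by linarith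
          gcongr
      _ = Q₀ * Y ^ (n + 2) := by rw [hQ₀]; ring
  calc (D + (T : ℝ) ^ n * (3 + T * (D * (1 + Real.log X)))) ^ n
      ≤ (Q₀ * Y ^ (n + 2)) ^ n := by gcongr
    _ = Q₀ ^ n * (V : ℝ) ^ (K * δ * ((n + 2) * n)) := by
        rw [mul_pow, ← pow_mul, hY, ← Real.rpow_natCast ((V : ℝ) ^ (K * δ)),
          ← Real.rpow_mul hV0.le]
        push_cast
        rfl
    _ ≤ (Q₀ ^ n + 1) * (V : ℝ) ^ ε := by
        have hle : K * δ * ((n + 2) * n) ≤ ε := by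
          rw [hδ, mul_comm (K : ℝ), mul_assoc, div_mul_eq_mul_div, div_le_iff₀ (by positivity)]
          nlinarith
        have hQ0 : 0 ≤ Q₀ ^ n := by positivity
        gcongr
        linarith

/-- For an irreducible `f` of bounded degree and polynomially bounded coefficients, there are at
most `V ^ (r + o(1))` tuples in a box of side `V` for which `f` divides the numerator of
`∑ᵢ sᵢ / (X + wᵢ)`. -/
theorem exists_card_le_of_common_factor (r d κ c : ℕ) (hc : 1 ≤ c) {ε : ℝ} (hε : 0 < ε) :
    ∃ A : ℝ, 0 < A ∧ ∀ V : ℕ, 1 ≤ V → ∀ f : ℤ[X], Irreducible f → 0 < f.natDegree →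
      f.natDegree ≤ d → (∀ k, |f.coeff k| ≤ c * V ^ κ) →
      ∀ s : Fin (r + r) → ℤ, (∀ i, |s i| = 1) → ∀ W : Finset (Fin (r + r) → ℤ),
        (∀ w ∈ W, (∀ i, w i ∈ Icc (-(V : ℤ)) V) ∧
          (signedCount s w = 0 ∨ f ∣ reciprocalNum (signedCount s w))) →
        (#W : ℝ) ≤ A * V ^ r * (V : ℝ) ^ ε := by
  -- `M * V ^ K` bounds both the values of `f` and the square of the resultant of `f` and `f'`.
  set M₁ : ℕ := (d + 1) * c with hM₁
  set M₂ : ℕ := ((2 * (d + 1)).factorial * ((d + 1) * c) ^ (2 * (d + 1))) ^ 2 with hM₂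
  set K₁ : ℕ := κ + d with hK₁
  set K₂ : ℕ := κ * (2 * (d + 1)) * 2 with hK₂
  set M := M₁ + M₂ with hM
  set K := K₁ + K₂ with hK
  have hM₁1 : 1 ≤ M₁ := Nat.mul_pos (by omega) hc
  obtain ⟨δ, hδ, hbound⟩ := exists_pow_bound (r + r) (2 * d) K M (by omega) hε
  obtain ⟨C₀, hC₀, hdiv⟩ := exists_card_divisors_le_rpow hδ
  obtain ⟨A, hA, hfin⟩ := hbound C₀ hC₀
  refine ⟨2 * A, by positivity, fun V hV f hirr hdeg hfd hfc s hs W hW => ?_⟩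
  have hVz : (1 : ℤ) ≤ V := by exact_mod_cast hV
  have hle1 : M₁ * V ^ K₁ ≤ M * V ^ K :=
    Nat.mul_le_mul (by omega) (Nat.pow_le_pow_right hV (by omega))
  have hle2 : M₂ * V ^ K₂ ≤ M * V ^ K :=
    Nat.mul_le_mul (by omega) (Nat.pow_le_pow_right hV (by omega))
  have hX : ∀ x ∈ Icc (-(V : ℤ)) V, (f.eval (-x)).natAbs ≤ M₁ * V ^ K₁ := by
    intro x hx
    refine (natAbs_eval_neg_le (c := c * V ^ κ) hV hfd (by exact_mod_cast hfc) hx).trans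
      (le_of_eq ?_)
    rw [hM₁, hK₁]; ring
  obtain ⟨a, b, -, -, hE⟩ := exists_mul_add_mul_eq_C_resultant f (derivative f) le_rfl le_rfl
    (Or.inl hdeg.ne')
  set E := resultant f (derivative f) with hEdef
  have hE0 : E ≠ 0 := resultant_derivative_ne_zero hirr hdeg
  have hEbd : E.natAbs ^ 2 ≤ M₂ * V ^ K₂ := by
    have hcc : (1 : ℤ) ≤ (d + 1) * c * V ^ κ := by
      have h : 1 ≤ (d + 1) * c * V ^ κ := Nat.mul_pos hM₁1 (Nat.pow_pos hV)
      exact_mod_cast h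
    have hcV : (0 : ℤ) ≤ c * V ^ κ := by positivity
    have hres := abs_resultant_le (P := f) (Q := derivative f) (V := 1)
      (c := (d + 1) * c * V ^ κ) (S := d + 1) le_rfl hcc (by omega)
      ((natDegree_derivative_le f).trans_lt (by omega)) ?_ ?_
    · rw [one_pow, mul_one, ← hEdef] at hres
      have hres' : E.natAbs ≤
          (2 * (d + 1)).factorial * ((d + 1) * c * V ^ κ) ^ (2 * (d + 1)) := by
        zify; exact hres
      refine (Nat.pow_le_pow_left hres' 2).trans (le_of_eq ?_)
      rw [hM₂, hK₂, pow_mul V, pow_mul V, mul_pow ((d + 1) * c)]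
      ring
    · intro k
      simp only [one_pow, mul_one]
      refine (hfc k).trans ?_
      nlinarith
    · intro k
      simp only [one_pow, mul_one]
      rw [coeff_derivative, abs_mul]
      rcases Nat.lt_or_ge f.natDegree (k + 1) with h | h
      · rw [coeff_eq_zero_of_natDegree_lt h, abs_zero, zero_mul]
        omega
      · have hk : |((k : ℤ) + 1)| ≤ d + 1 := by
          rw [abs_of_nonneg (by positivity)]
          have : ((k + 1 : ℕ) : ℤ) ≤ d := by exact_mod_cast h.trans hfd
          push_cast at this
          linarith
        calc |f.coeff (k + 1)| * |((k : ℤ) + 1)| ≤ (c * V ^ κ) * (d + 1) :=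
              mul_le_mul (hfc _) hk (abs_nonneg _) hcV
          _ = _ := by ring
  have hEn : E.natAbs ^ 2 ≠ 0 := pow_ne_zero 2 (Int.natAbs_ne_zero.mpr hE0)
  have hdivT : ∀ n : ℕ, n ≠ 0 → n ≤ M * V ^ K →
      #n.divisors ≤ ⌊C₀ * ((M : ℝ) * V ^ K) ^ δ⌋₊ := by
    intro n hn hnle
    refine Nat.le_floor ((hdiv n hn).trans ?_)
    have : (n : ℝ) ≤ (M : ℝ) * V ^ K := by exact_mod_cast hnle
    gcongr
  have hX1 : 1 ≤ M₁ * V ^ K₁ := Nat.mul_pos hM₁1 (Nat.pow_pos hV)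
  have hcount := card_mutually_dividing_le (F := fun x => f.eval (-x))
    (dvd_eval_neg_sub_eval_neg f) (D := 2 * d) (X := M₁ * V ^ K₁) hEn hV hX hX1
    (fun k => (card_natAbs_eval_eq_le hdeg _ k).trans (by omega))
    (hdivT _ hEn (hEbd.trans hle2))
    (fun x hx h0 => hdivT _ (Int.natAbs_ne_zero.mpr h0) ((hX x hx).trans hle1))
    (fun w hw => (hW w hw).1)
    (fun w hw i hi0 => strippedValue_dvd_sharedPart_of_signedCount hs (hW w hw).2 hE0 hE i hi0)
  refine hcount.trans ?_
  have := hfin V ⌊C₀ * ((M : ℝ) * V ^ K) ^ δ⌋₊ (M₁ * V ^ K₁) hV hX1 hle1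
    (Nat.floor_le (by positivity))
  calc _ ≤ 2 * (V : ℝ) ^ r * (A * (V : ℝ) ^ ε) := by gcongr
    _ = _ := by ring

/-! ### The congruence on short intervals -/

/-- The signs with which the `2r` reciprocals enter the congruence. -/
def reciprocalSign (r : ℕ) : Fin (r + r) → ℤ :=
  Fin.append (fun _ => 1) fun _ => -1

lemma abs_reciprocalSign (r : ℕ) (i : Fin (r + r)) : |reciprocalSign r i| = 1 := by
  induction i using Fin.addCases <;>
    simp [reciprocalSign, -Fin.natAdd_eq_addNat]

lemma sum_reciprocalSign (r : ℕ) : ∑ i, reciprocalSign r i = 0 := by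
  simp [reciprocalSign, Fin.sum_univ_add, -Fin.natAdd_eq_addNat]

/-- Clearing denominators in the congruence. -/
lemma dvd_eval_reciprocalNum {r q : ℕ} {lam : ℤ} {v : (Fin r → ℤ) × (Fin r → ℤ)}
    (hv : IsKloostermanSolution r q lam v) :
    (q : ℤ) ∣ (reciprocalNum (signedCount (reciprocalSign r) (Fin.append v.1 v.2))).eval lam := by
  obtain ⟨h1, h2, hsum⟩ := hv
  set w := Fin.append v.1 v.2 with hw
  set m := signedCount (reciprocalSign r) w with hm
  have hunit : ∀ i, IsUnit ((lam : ZMod q) + (w i : ℤ)) := by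
    intro i
    induction i using Fin.addCases with
    | left i => simpa [hw] using h1 i
    | right i => simpa [hw, -Fin.natAdd_eq_addNat] using h2 i
  have hunit' : ∀ u ∈ m.support, IsUnit ((lam : ZMod q) + (u : ℤ)) := by
    intro u hu
    obtain ⟨i, -, rfl⟩ := Finset.mem_image.mp (support_signedCount_subset _ _ hu)
    exact hunit i
  rw [← ZMod.intCast_zmod_eq_zero_iff_dvd]
  have haev : (((reciprocalNum m).eval lam : ℤ) : ZMod q) =
      aeval (lam : ZMod q) (reciprocalNum m) := by
    rw [aeval_def, eval₂_at_intCast]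
    simp
  rw [haev, aeval_reciprocalNum]
  have hterm : ∀ u ∈ m.support, (m u : ZMod q) * ∏ l ∈ m.support.erase u, ((lam : ZMod q) + l) =
      (∏ l ∈ m.support, ((lam : ZMod q) + l)) * (m u * ((lam : ZMod q) + u)⁻¹) := by
    intro u hu
    rw [← Finset.mul_prod_erase _ _ hu]
    linear_combination (-(m u : ZMod q) * ∏ l ∈ m.support.erase u, ((lam : ZMod q) + l)) *
      ZMod.mul_inv_of_unit _ (hunit' u hu)
  rw [Finset.sum_congr rfl hterm, ← Finset.mul_sum,
    sum_signedCount_mul (reciprocalSign r) w fun u : ℤ => ((lam : ZMod q) + u)⁻¹,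
    Fin.sum_univ_add]
  simp only [Int.cast_add] at hsum
  simp [reciprocalSign, hw, hsum, -Fin.natAdd_eq_addNat]

/-- The bound for short ranges, where the resultants are too small to be nonzero multiples
of `q`. -/
theorem exists_kloostermanCount_le_of_pow_lt (r : ℕ) (hr : 2 ≤ r) :
    ∃ c₁ : ℕ, 1 ≤ c₁ ∧ ∀ ε : ℝ, 0 < ε → ∃ A : ℝ, 0 < A ∧ ∀ (q : ℕ) (lam : ℤ) (V : ℕ), 1 ≤ V →
      c₁ * V ^ (4 * r * (r - 1)) < q →
      (kloostermanCount r q lam V : ℝ) ≤ A * (V : ℝ) ^ r * (V : ℝ) ^ ε := by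
  classical
  set S : ℕ := 2 * r - 1 with hS
  have hSexp : S ^ 2 - 1 = 4 * r * (r - 1) := by
    obtain ⟨k, rfl⟩ := Nat.exists_eq_add_of_le hr
    have h1 : S = 2 * k + 3 := by omega
    have h2 : 2 + k - 1 = k + 1 := by omega
    rw [h1, h2, Nat.sub_eq_iff_eq_add (Nat.one_le_pow _ _ (by omega))]
    ring
  set c : ℕ := 2 * r * 2 ^ S with hc
  have hc1 : 1 ≤ c := Nat.mul_pos (by omega) (by positivity)
  set c₁ : ℕ := (2 * S).factorial * c ^ (2 * S) with hc₁
  have hcc₁ : c ≤ c₁ := by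
    calc c = c ^ 1 := (pow_one c).symm
      _ ≤ c ^ (2 * S) := Nat.pow_le_pow_right hc1 (by omega)
      _ ≤ c₁ := Nat.le_mul_of_pos_left _ (Nat.factorial_pos _)
  refine ⟨c₁, hc1.trans hcc₁, fun ε hε => ?_⟩
  set c₂ : ℕ := 2 ^ (2 * r) * ((2 * r + 1) * c) with hc₂
  have hc₂1 : 1 ≤ c₂ := Nat.mul_pos (by positivity) (Nat.mul_pos (by omega) hc1)
  obtain ⟨A, hA, hbound⟩ := exists_card_le_of_common_factor r (2 * r) S c₂ hc₂1 hε
  refine ⟨(2 * r + 1) * A, by positivity, fun q lam V hV hq => ?_⟩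
  have hVz : (1 : ℤ) ≤ V := by exact_mod_cast hV
  set sols := (((Fintype.piFinset fun _ : Fin r => Icc (-(V : ℤ)) V) ×ˢ
    (Fintype.piFinset fun _ : Fin r => Icc (-(V : ℤ)) V)).filter
      (IsKloostermanSolution r q lam)) with hsols
  let R : (Fin (r + r) → ℤ) → ℤ[X] := fun w => reciprocalNum (signedCount (reciprocalSign r) w)
  set W : Finset (Fin (r + r) → ℤ) := sols.image fun v => Fin.append v.1 v.2 with hWdef
  have hcard : kloostermanCount r q lam V = #W := by
    rw [hWdef, Finset.card_image_of_injective]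
    · rfl
    · intro v v' h
      exact (Fin.appendEquiv r r).injective h
  have hWbox : ∀ w ∈ W, ∀ i, w i ∈ Icc (-(V : ℤ)) V := by
    intro w hw i
    obtain ⟨v, hv, rfl⟩ := Finset.mem_image.mp hw
    obtain ⟨hv1, hv2⟩ := Finset.mem_product.mp (Finset.mem_filter.mp hv).1
    induction i using Fin.addCases with
    | left i => simpa using Fintype.mem_piFinset.mp hv1 i
    | right i => simpa [-Fin.natAdd_eq_addNat] using Fintype.mem_piFinset.mp hv2 i
  have hWdvd : ∀ w ∈ W, (q : ℤ) ∣ (R w).eval lam := by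
    intro w hw
    obtain ⟨v, hv, rfl⟩ := Finset.mem_image.mp hw
    exact dvd_eval_reciprocalNum (Finset.mem_filter.mp hv).2
  have hsupp : ∀ w, #(signedCount (reciprocalSign r) w).support ≤ 2 * r := fun w =>
    (card_support_signedCount_le _ _).trans (by simp; omega)
  have hcoeff : ∀ w ∈ W, ∀ k, |(R w).coeff k| * (V : ℤ) ^ k ≤ c * (V : ℤ) ^ S := by
    intro w hw k
    refine (abs_coeff_reciprocalNum_mul_pow_le hVz (S := S) ?_
      ((hsupp w).trans (by omega)) k).trans ?_
    · intro l hl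
      obtain ⟨i, -, rfl⟩ := Finset.mem_image.mp (support_signedCount_subset _ _ hl)
      exact abs_le.mpr (Finset.mem_Icc.mp (hWbox w hw i))
    · have h1 := sum_abs_signedCount_le w (abs_reciprocalSign r)
      rw [Fintype.card_fin] at h1
      calc _ ≤ ((r + r : ℕ) : ℤ) * (2 * (V : ℤ)) ^ S := by gcongr
        _ = _ := by rw [hc, mul_pow]; push_cast; ring
  have hdeg : ∀ w, (R w).natDegree < S := by
    intro w
    have := natDegree_reciprocalNum_le (m := signedCount (reciprocalSign r) w)
      (by rw [sum_signedCount, sum_reciprocalSign])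
    have := hsupp w
    simp only [R]
    omega
  have hsmall : ∀ x : ℤ, (q : ℤ) ∣ x → |x| ≤ c₁ * (V : ℤ) ^ (4 * r * (r - 1)) → x = 0 := by
    intro x hx hle
    refine Int.eq_zero_of_abs_lt_dvd hx (hle.trans_lt ?_)
    exact_mod_cast hq
  -- All solutions outside the diagonal share an irreducible factor with a fixed one.
  obtain ⟨Φ, hΦcard, hΦ, hΦW⟩ : ∃ Φ : Finset ℤ[X], #Φ ≤ 2 * r + 1 ∧
      (∀ f ∈ Φ, Irreducible f ∧ 0 < f.natDegree ∧ f.natDegree ≤ 2 * r ∧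
        ∀ k, |f.coeff k| ≤ c₂ * (V : ℤ) ^ S) ∧
      ∀ w ∈ W, ∃ f ∈ Φ, signedCount (reciprocalSign r) w = 0 ∨ f ∣ R w := by
    have hX : Irreducible (X : ℤ[X]) ∧ 0 < (X : ℤ[X]).natDegree ∧ (X : ℤ[X]).natDegree ≤ 2 * r ∧
        ∀ k, |(X : ℤ[X]).coeff k| ≤ c₂ * (V : ℤ) ^ S := by
      refine ⟨irreducible_X, by simp, by rw [natDegree_X]; omega, fun k => ?_⟩
      have h1 : (1 : ℤ) ≤ c₂ * (V : ℤ) ^ S := by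
        exact_mod_cast Nat.mul_pos hc₂1 (Nat.pow_pos hV)
      rw [coeff_X]
      split_ifs
      · simpa using h1
      · rw [abs_zero]; omega
    by_cases hdiag : ∀ w ∈ W, signedCount (reciprocalSign r) w = 0
    · exact ⟨{X}, by simp, by simpa using hX, fun w hw => ⟨X, by simp, Or.inl (hdiag w hw)⟩⟩
    push Not at hdiag
    obtain ⟨w₀, hw₀, hm₀⟩ := hdiag
    have hR₀ : R w₀ ≠ 0 := reciprocalNum_ne_zero hm₀
    have hR₀deg : (R w₀).natDegree ≠ 0 := by
      intro h0
      obtain ⟨a, ha⟩ : ∃ a, R w₀ = C a := ⟨_, eq_C_of_natDegree_eq_zero h0⟩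
      have hdvd := hWdvd w₀ hw₀
      have hco := hcoeff w₀ hw₀ 0
      rw [ha, eval_C] at hdvd
      rw [ha, coeff_C_zero, pow_zero, mul_one] at hco
      apply hR₀
      rw [ha, hsmall a hdvd (hco.trans ?_), C_0]
      have hexp : S ≤ 4 * r * (r - 1) := by
        rw [← hSexp]
        have : 3 ≤ S := by omega
        have : S * 3 ≤ S ^ 2 := by nlinarith
        omega
      have hcc : (c : ℤ) ≤ c₁ := by exact_mod_cast hcc₁
      have hVp : (V : ℤ) ^ S ≤ (V : ℤ) ^ (4 * r * (r - 1)) := pow_le_pow_right₀ hVz hexp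
      gcongr
    set Ψ := ((UniqueFactorizationMonoid.normalizedFactors (R w₀)).filter
      fun f => 0 < f.natDegree) with hΨ
    refine ⟨insert X Ψ.toFinset, ?_, ?_, ?_⟩
    · refine (Finset.card_insert_le _ _).trans (Nat.succ_le_succ ?_)
      refine (Multiset.toFinset_card_le _).trans ?_
      have hdvd : Ψ.prod ∣ R w₀ :=
        (Multiset.prod_dvd_prod_of_le (Multiset.filter_le _ _)).trans
          (UniqueFactorizationMonoid.prod_normalizedFactors hR₀).dvd
      have h0 : (0 : ℤ[X]) ∉ Ψ := fun h => by simpa using (Multiset.mem_filter.mp h).2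
      calc Ψ.card ≤ (Ψ.map natDegree).sum := by
            have := Multiset.card_nsmul_le_sum (s := Ψ.map natDegree) (a := 1) (by
              intro x hx
              obtain ⟨f, hf, rfl⟩ := Multiset.mem_map.mp hx
              exact (Multiset.mem_filter.mp hf).2)
            simpa using this
        _ = Ψ.prod.natDegree := (natDegree_multiset_prod _ h0).symm
        _ ≤ (R w₀).natDegree := natDegree_le_of_dvd hdvd hR₀
        _ ≤ 2 * r := by have := hdeg w₀; omega
    · intro f hf
      rcases Finset.mem_insert.mp hf with rfl | hf
      · exact hX
      obtain ⟨hfn, hfd⟩ := Multiset.mem_filter.mp (Multiset.mem_toFinset.mp hf)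
      have hfdvd := UniqueFactorizationMonoid.dvd_of_mem_normalizedFactors hfn
      refine ⟨UniqueFactorizationMonoid.irreducible_of_normalized_factor f hfn, hfd,
        (natDegree_le_of_dvd hfdvd hR₀).trans (by have := hdeg w₀; omega), fun k => ?_⟩
      have hco : ∀ k, |((R w₀).coeff k : ℝ)| ≤ c * (V : ℝ) ^ S := by
        intro k
        have h1 : |(R w₀).coeff k| ≤ |(R w₀).coeff k| * (V : ℤ) ^ k :=
          le_mul_of_one_le_right (abs_nonneg _) (one_le_pow₀ hVz)
        exact_mod_cast h1.trans (hcoeff w₀ hw₀ k)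
      have := abs_coeff_le_of_dvd hR₀ hfdvd (d := 2 * r) (by have := hdeg w₀; omega) hco k
      have h2 : (2 : ℝ) ^ (2 * r) * (((2 * r : ℕ) + 1) * (c * (V : ℝ) ^ S)) = c₂ * (V : ℝ) ^ S := by
        rw [hc₂]; push_cast; ring
      rw [h2] at this
      exact_mod_cast this
    · intro w hw
      by_cases hm : signedCount (reciprocalSign r) w = 0
      · exact ⟨X, Finset.mem_insert_self _ _, Or.inl hm⟩
      have hres : resultant (R w₀) (R w) = 0 := by
        refine hsmall _ ?_ ?_
        · obtain ⟨a, b, -, -, hab⟩ := exists_mul_add_mul_eq_C_resultant (R w₀) (R w) le_rfl le_rfl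
            (Or.inl hR₀deg)
          have := congrArg (eval lam) hab
          rw [eval_C, eval_add, eval_mul, eval_mul] at this
          rw [← this]
          exact dvd_add ((hWdvd w₀ hw₀).mul_right _) ((hWdvd w hw).mul_right _)
        · have := abs_resultant_le hVz (by exact_mod_cast hc1) (hdeg w₀) (hdeg w)
            (hcoeff w₀ hw₀) (hcoeff w hw)
          rw [hSexp] at this
          rw [hc₁]
          push_cast
          exact this
      obtain ⟨f, hf, hfd, hfR⟩ := exists_common_factor_of_resultant_eq_zero hR₀ hres
      exact ⟨f, Finset.mem_insert_of_mem (Multiset.mem_toFinset.mpr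
        (Multiset.mem_filter.mpr ⟨hf, hfd⟩)), Or.inr hfR⟩
  have hcover : W ⊆ Φ.biUnion fun f =>
      W.filter fun w => signedCount (reciprocalSign r) w = 0 ∨ f ∣ R w := by
    intro w hw
    obtain ⟨f, hf, h⟩ := hΦW w hw
    exact Finset.mem_biUnion.mpr ⟨f, hf, Finset.mem_filter.mpr ⟨hw, h⟩⟩
  rw [hcard]
  calc (#W : ℝ) ≤ ((∑ f ∈ Φ, #(W.filter fun w =>
        signedCount (reciprocalSign r) w = 0 ∨ f ∣ R w) : ℕ) : ℝ) := by
        exact_mod_cast (Finset.card_le_card hcover).trans Finset.card_biUnion_le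
    _ ≤ ∑ f ∈ Φ, A * V ^ r * (V : ℝ) ^ ε := by
        push_cast
        refine Finset.sum_le_sum fun f hf => ?_
        obtain ⟨hirr, hpos, hle, hco⟩ := hΦ f hf
        refine hbound V hV f hirr hpos hle hco _ (abs_reciprocalSign r) _ fun w hw => ?_
        obtain ⟨hwW, hw⟩ := Finset.mem_filter.mp hw
        exact ⟨hWbox w hwW, hw⟩
    _ = #Φ * (A * V ^ r * (V : ℝ) ^ ε) := by rw [Finset.sum_const, nsmul_eq_mul]
    _ ≤ (2 * r + 1) * (A * V ^ r * (V : ℝ) ^ ε) := by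
        have : (#Φ : ℝ) ≤ 2 * r + 1 := by exact_mod_cast hΦcard
        gcongr
    _ = _ := by ring

/-! ### Subdividing the interval -/

/-- The character sum `∑_{|x| ≤ V} ψ (1 / (lam + x))` over the `x` with `lam + x` invertible
modulo `q`. -/
noncomputable def reciprocalCharSum {q : ℕ} (ψ : AddChar (ZMod q) ℂ) (lam : ℤ) (V : ℕ) : ℂ :=
  open Classical in
  ∑ x ∈ Icc (-(V : ℤ)) V,
    if IsUnit ((lam + x : ℤ) : ZMod q) then ψ ((lam + x : ℤ) : ZMod q)⁻¹ else 0

lemma addChar_map_sum {ι G R : Type*} [AddCommMonoid G] [CommMonoid R] (ψ : AddChar G R)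
    (s : Finset ι) (f : ι → G) : ψ (∑ i ∈ s, f i) = ∏ i ∈ s, ψ (f i) :=
  map_prod ψ.toMonoidHom (fun i => Multiplicative.ofAdd (f i)) s

/-- Orthogonality of characters: `K_{r,q}` is a `2r`-th moment of character sums. -/
lemma sum_norm_reciprocalCharSum_pow {q : ℕ} [NeZero q] (r : ℕ) (lam : ℤ) (V : ℕ) :
    ∑ ψ : AddChar (ZMod q) ℂ, ‖reciprocalCharSum ψ lam V‖ ^ (2 * r) =
      q * kloostermanCount r q lam V := by
  classical
  set I := Icc (-(V : ℤ)) V with hI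
  set J := Fintype.piFinset fun _ : Fin r => I with hJ
  let U : (Fin r → ℤ) → Prop := fun v => ∀ i, IsUnit ((lam + v i : ℤ) : ZMod q)
  let σ : (Fin r → ℤ) → ZMod q := fun v => ∑ i, ((lam + v i : ℤ) : ZMod q)⁻¹
  have hpow : ∀ ψ : AddChar (ZMod q) ℂ,
      reciprocalCharSum ψ lam V ^ r = ∑ v ∈ J, if U v then ψ (σ v) else 0 := by
    intro ψ
    rw [reciprocalCharSum, Finset.sum_pow']
    refine Finset.sum_congr rfl fun v _ => ?_
    by_cases hU : U v
    · rw [if_pos hU, addChar_map_sum]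
      exact Finset.prod_congr rfl fun i _ => if_pos (hU i)
    · rw [if_neg hU]
      obtain ⟨i, hi⟩ := not_forall.mp hU
      exact Finset.prod_eq_zero (mem_univ i) (if_neg hi)
  have hmoment : ∀ ψ : AddChar (ZMod q) ℂ,
      ((‖reciprocalCharSum ψ lam V‖ ^ (2 * r) : ℝ) : ℂ) =
        ∑ p ∈ J ×ˢ J, if U p.1 ∧ U p.2 then ψ (σ p.1 - σ p.2) else 0 := by
    intro ψ
    rw [pow_mul, Complex.ofReal_pow, Complex.ofReal_pow, ← Complex.mul_conj', mul_pow,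
      ← map_pow, hpow, map_sum, Finset.sum_mul_sum, ← Finset.sum_product']
    refine Finset.sum_congr rfl fun p _ => ?_
    by_cases h1 : U p.1 <;> by_cases h2 : U p.2
    · simp only [h1, h2, and_self, if_true]
      rw [sub_eq_add_neg, AddChar.map_add_eq_mul, AddChar.map_neg_eq_conj]
    all_goals simp [h1, h2]
  apply Complex.ofReal_injective
  rw [Complex.ofReal_sum, Finset.sum_congr rfl fun ψ _ => hmoment ψ, Finset.sum_comm]
  have horth : ∀ p : (Fin r → ℤ) × (Fin r → ℤ),
      ∑ ψ : AddChar (ZMod q) ℂ, (if U p.1 ∧ U p.2 then ψ (σ p.1 - σ p.2) else 0) =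
        if IsKloostermanSolution r q lam p then (q : ℂ) else 0 := by
    intro p
    by_cases h : U p.1 ∧ U p.2
    · simp only [if_pos h]
      rw [AddChar.sum_apply_eq_ite, ZMod.card]
      exact if_congr ⟨fun h' => ⟨h.1, h.2, sub_eq_zero.mp h'⟩, fun h' => sub_eq_zero.mpr h'.2.2⟩
        rfl rfl
    · simp only [if_neg h, Finset.sum_const_zero]
      rw [if_neg fun h' => h ⟨h'.1, h'.2.1⟩]
  rw [Finset.sum_congr rfl fun p _ => horth p, ← Finset.sum_filter, Finset.sum_const,
    nsmul_eq_mul, kloostermanCount]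
  push_cast
  rw [mul_comm]

lemma reciprocalCharSum_split {q : ℕ} (ψ : AddChar (ZMod q) ℂ) (lam : ℤ) (W T : ℕ) :
    reciprocalCharSum ψ lam ((2 * W + 1) * T + W) =
      ∑ t ∈ Icc (-(T : ℤ)) T, reciprocalCharSum ψ (lam + (2 * W + 1) * t) W := by
  classical
  simp only [reciprocalCharSum]
  rw [← Finset.sum_product']
  symm
  have hpos : (0 : ℤ) < 2 * W + 1 := by positivity
  refine Finset.sum_nbij' (fun p => (2 * W + 1) * p.1 + p.2)
    (fun x => ((x + W) / (2 * W + 1), (x + W) % (2 * W + 1) - W)) ?_ ?_ ?_ ?_ ?_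
  · rintro ⟨t, y⟩ hp
    simp only [Finset.mem_product, Finset.mem_Icc] at hp ⊢
    push_cast
    constructor <;> nlinarith
  · intro x hx
    simp only [Finset.mem_product, Finset.mem_Icc] at hx ⊢
    push_cast at hx
    have h1 := Int.emod_nonneg (x + W) hpos.ne'
    have h2 := Int.emod_lt_of_pos (x + W) hpos
    refine ⟨⟨?_, ?_⟩, by omega, by omega⟩
    · rw [Int.le_ediv_iff_mul_le hpos]; nlinarith
    · rw [← Int.lt_add_one_iff, Int.ediv_lt_iff_lt_mul hpos]; nlinarith
  · rintro ⟨t, y⟩ hp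
    simp only [Finset.mem_product, Finset.mem_Icc] at hp
    have h1 : (2 * (W : ℤ) + 1) * t + y + W = (y + W) + (2 * W + 1) * t := by ring
    have h2 : (0 : ℤ) ≤ y + W := by omega
    have h3 : y + W < 2 * W + 1 := by omega
    simp only [h1, Int.add_mul_ediv_left _ _ hpos.ne', Int.add_mul_emod_self_left,
      Int.ediv_eq_zero_of_lt h2 h3, Int.emod_eq_of_lt h2 h3]
    simp
  · intro x _
    have := Int.mul_ediv_add_emod (x + W) (2 * W + 1)
    simp only
    linarith
  · rintro ⟨t, y⟩ _
    simp only [add_assoc]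

lemma kloostermanCount_mono (r q : ℕ) (lam : ℤ) {V V' : ℕ} (h : V ≤ V') :
    kloostermanCount r q lam V ≤ kloostermanCount r q lam V' := by
  classical
  have hI : Icc (-(V : ℤ)) V ⊆ Icc (-(V' : ℤ)) V' := Finset.Icc_subset_Icc (by omega) (by omega)
  have hJ := Fintype.piFinset_subset (fun _ : Fin r => Icc (-(V : ℤ)) V) _ fun _ => hI
  exact Finset.card_le_card (Finset.filter_subset_filter _ (Finset.product_subset_product hJ hJ))

/-- Hölder's inequality: the count over a long range is controlled by the counts over the
subintervals of a subdivision. -/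
lemma kloostermanCount_le_sum {q : ℕ} [NeZero q] {r : ℕ} (hr : 1 ≤ r) (lam : ℤ) {V W T : ℕ}
    (hV : V ≤ (2 * W + 1) * T + W) :
    (kloostermanCount r q lam V : ℝ) ≤ (2 * T + 1 : ℝ) ^ (2 * r - 1) *
      ∑ t ∈ Icc (-(T : ℤ)) T, (kloostermanCount r q (lam + (2 * W + 1) * t) W : ℝ) := by
  have hq : (0 : ℝ) < q := by exact_mod_cast NeZero.pos q
  have hmono : (kloostermanCount r q lam V : ℝ) ≤
      kloostermanCount r q lam ((2 * W + 1) * T + W) := by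
    exact_mod_cast kloostermanCount_mono r q lam hV
  refine hmono.trans ?_
  refine le_of_mul_le_mul_left ?_ hq
  rw [← sum_norm_reciprocalCharSum_pow, ← mul_assoc, mul_comm (q : ℝ), mul_assoc, Finset.mul_sum,
    Finset.sum_congr rfl fun t _ => (sum_norm_reciprocalCharSum_pow r _ W).symm, Finset.sum_comm,
    Finset.mul_sum]
  refine Finset.sum_le_sum fun ψ _ => ?_
  rw [reciprocalCharSum_split]
  obtain ⟨n, hn⟩ : ∃ n, 2 * r = n + 1 := ⟨2 * r - 1, by omega⟩
  have hcard : #(Icc (-(T : ℤ)) T) = 2 * T + 1 := by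
    rw [Int.card_Icc]; omega
  have hpm := pow_sum_le_card_mul_sum_pow (s := Icc (-(T : ℤ)) T)
    (f := fun t => ‖reciprocalCharSum ψ (lam + (2 * W + 1) * t) W‖) (fun _ _ => norm_nonneg _) n
  rw [hcard] at hpm
  push_cast at hpm
  rw [hn, Nat.add_sub_cancel]
  exact (pow_le_pow_left₀ (norm_nonneg _) (norm_sum_le _ _) _).trans hpm

lemma kloostermanCount_le_pow (r q : ℕ) (lam : ℤ) (V : ℕ) :
    kloostermanCount r q lam V ≤ (2 * V + 1) ^ (2 * r) := by
  classical
  refine (Finset.card_filter_le _ _).trans (le_of_eq ?_)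
  have hcard : #(Icc (-(V : ℤ)) V) = 2 * V + 1 := by
    rw [Int.card_Icc]; omega
  rw [Finset.card_product, Fintype.card_piFinset, Finset.prod_const, hcard, Finset.card_univ,
    Fintype.card_fin, ← pow_add, two_mul r]

theorem lemma13 (r : ℕ) (hr : 2 ≤ r) (C : ℝ) (hC : 0 < C) (ε : ℝ) (hε : 0 < ε) :
    ∃ A : ℝ, 0 < A ∧ ∀ q : ℕ, 1 ≤ q → ∀ (lam : ℤ) (V : ℕ), 1 ≤ V →
      (V : ℝ) ≤ C * (q : ℝ) ^ (1 / (4 * (r : ℝ) * ((r : ℝ) - 1))) →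
      (kloostermanCount r q lam V : ℝ) ≤ A * (V : ℝ) ^ r * (q : ℝ) ^ ε := by
  obtain ⟨c₁, hc₁, hshort⟩ := exists_kloostermanCount_le_of_pow_lt r hr
  obtain ⟨A₀, hA₀, hA⟩ := hshort ε hε
  have hc₁0 : (0 : ℝ) < c₁ := by exact_mod_cast hc₁
  have hc₁1 : (1 : ℝ) ≤ c₁ := by exact_mod_cast hc₁
  set T : ℕ := ⌈4 * c₁ * C⌉₊ with hT
  set B : ℝ := (2 * (C * (2 * c₁)) + 1) ^ (2 * r) with hB
  refine ⟨B + (2 * T + 1) ^ (2 * r) * A₀, by positivity, fun q hq lam V hV hVq => ?_⟩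
  have : NeZero q := ⟨by omega⟩
  set k : ℕ := 4 * r * (r - 1) with hk
  have hk0 : k ≠ 0 := (Nat.mul_pos (by omega) (by omega)).ne'
  have hkr : 4 * (r : ℝ) * ((r : ℝ) - 1) = k := by
    rw [hk]; push_cast [show 1 ≤ r by omega]; ring
  rw [hkr] at hVq
  set x : ℝ := (q : ℝ) ^ (1 / (k : ℝ)) with hx
  have hq1 : (1 : ℝ) ≤ q := by exact_mod_cast hq
  have hx0 : 0 < x := by positivity
  have hxk : x ^ k = q := by
    rw [hx, one_div]
    exact Real.rpow_inv_natCast_pow (by positivity) hk0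
  have hV1 : (1 : ℝ) ≤ V := by exact_mod_cast hV
  have hVr : 1 ≤ (V : ℝ) ^ r := one_le_pow₀ hV1
  have hqε : 1 ≤ (q : ℝ) ^ ε := Real.one_le_rpow hq1 hε.le
  rcases lt_or_ge x (2 * c₁) with hsmall | hlarge
  -- Here `q`, and hence `V`, is bounded.
  · have h1 : (kloostermanCount r q lam V : ℝ) ≤ (2 * V + 1) ^ (2 * r) := by
      exact_mod_cast kloostermanCount_le_pow r q lam V
    have h2 : (V : ℝ) ≤ C * (2 * c₁) := hVq.trans (by gcongr)
    calc (kloostermanCount r q lam V : ℝ) ≤ (2 * V + 1) ^ (2 * r) := h1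
      _ ≤ B := by rw [hB]; gcongr
      _ ≤ B + (2 * T + 1) ^ (2 * r) * A₀ := le_add_of_nonneg_right (by positivity)
      _ ≤ (B + (2 * T + 1) ^ (2 * r) * A₀) * (V : ℝ) ^ r :=
          le_mul_of_one_le_right (by positivity) hVr
      _ ≤ _ := le_mul_of_one_le_right (by positivity) hqε
  -- Otherwise the interval is subdivided into boundedly many short ones.
  · set W₀ : ℕ := ⌊x / (2 * c₁)⌋₊ with hW₀
    have hy1 : 1 ≤ x / (2 * c₁) := (one_le_div (by positivity)).mpr hlarge
    have hW₀1 : 1 ≤ W₀ := Nat.le_floor (by exact_mod_cast hy1)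
    have hW₀le : (W₀ : ℝ) ≤ x / (2 * c₁) := Nat.floor_le (by positivity)
    have hW₀ge : x ≤ 4 * c₁ * W₀ := by
      have h1 : x / (2 * c₁) < W₀ + 1 := Nat.lt_floor_add_one _
      have h2 : (1 : ℝ) ≤ W₀ := by exact_mod_cast hW₀1
      rw [div_lt_iff₀ (by positivity)] at h1
      nlinarith
    set W : ℕ := min V W₀ with hW
    have hW1 : 1 ≤ W := le_min hV hW₀1
    have hcover : V ≤ (2 * W + 1) * T + W := by
      rcases le_total V W₀ with h | h
      · rw [hW, min_eq_left h]; omega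
      · rw [hW, min_eq_right h]
        have : (V : ℝ) ≤ W₀ * T := by
          calc (V : ℝ) ≤ C * x := hVq
            _ ≤ C * (4 * c₁ * W₀) := by gcongr
            _ = W₀ * (4 * c₁ * C) := by ring
            _ ≤ W₀ * T := by gcongr; exact Nat.le_ceil _
        have : V ≤ W₀ * T := by exact_mod_cast this
        nlinarith
    have hWk : c₁ * W ^ k < q := by
      have h1 : (c₁ : ℝ) * (W : ℝ) ^ k < q := by
        have hWle : (W : ℝ) ≤ x / (2 * c₁) :=
          le_trans (by exact_mod_cast min_le_right V W₀) hW₀le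
        have h2c : 2 * (c₁ : ℝ) ≤ (2 * c₁) ^ k := le_self_pow₀ (by linarith) hk0
        calc (c₁ : ℝ) * (W : ℝ) ^ k ≤ c₁ * (x / (2 * c₁)) ^ k := by gcongr
          _ = c₁ * (q / (2 * c₁) ^ k) := by rw [div_pow, hxk]
          _ ≤ c₁ * (q / (2 * c₁)) := by gcongr
          _ = q / 2 := by field_simp
          _ < q := by linarith
      exact_mod_cast h1
    have hWq : (W : ℝ) ≤ q := by
      have : W ≤ q := calc
        W ≤ W ^ k := Nat.le_self_pow hk0 W
        _ ≤ c₁ * W ^ k := Nat.le_mul_of_pos_left _ hc₁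
        _ ≤ q := hWk.le
      exact_mod_cast this
    have hWV : (W : ℝ) ≤ V := by exact_mod_cast min_le_left V W₀
    have hcard : #(Icc (-(T : ℤ)) T) = 2 * T + 1 := by
      rw [Int.card_Icc]; omega
    calc (kloostermanCount r q lam V : ℝ)
        ≤ (2 * T + 1 : ℝ) ^ (2 * r - 1) * ∑ t ∈ Icc (-(T : ℤ)) T,
          (kloostermanCount r q (lam + (2 * W + 1) * t) W : ℝ) :=
          kloostermanCount_le_sum (by omega) lam hcover
      _ ≤ (2 * T + 1 : ℝ) ^ (2 * r - 1) * ∑ t ∈ Icc (-(T : ℤ)) T,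
          (A₀ * (V : ℝ) ^ r * (q : ℝ) ^ ε) := by
          gcongr with t _
          exact (hA q _ W hW1 hWk).trans (by gcongr)
      _ = (2 * T + 1 : ℝ) ^ (2 * r - 1) * (2 * T + 1) * (A₀ * (V : ℝ) ^ r * (q : ℝ) ^ ε) := by
          rw [Finset.sum_const, hcard, nsmul_eq_mul]
          push_cast
          ring
      _ = (2 * T + 1 : ℝ) ^ (2 * r) * A₀ * (V : ℝ) ^ r * (q : ℝ) ^ ε := by
          rw [← pow_succ, show 2 * r - 1 + 1 = 2 * r by omega]
          ring
      _ ≤ _ := by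
          gcongr
          exact le_add_of_nonneg_left (by positivity)
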